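/- Let $q$ be a prime power. An $O^+(8,q)$-space is an $8$-dimensional $\mathbb F_q$-space $V$ with a quadratic form $Q$ whose polar form is nondegenerate and which vanishes on some $4$-dimensional subspace; an $Sp(8,q)$-space is an $8$-dimensional $\mathbb F_q$-space with a nondegenerate alternating form. A subspace is totally singular (t.s.) if $Q$ vanishes on it, and totally isotropic (t.i.) if the bilinear form vanishes on it; a singular point is a t.s. $1$-space; $\perp$ refers to the polar form. An ovoid of $V$ is a set of singular points meeting every maximal t.s. subspace in exactly one member. An orthogonal (resp. symplectic) partial spread is a set of t.s. (resp. t.i.) $4$-spaces, any two of which meet only in $0$; "maximal" refers to inclusion. Two t.s. $4$-spaces have the same type if their intersection has even dimension (there are two types), and two t.s. $4$-spaces are incident if they are equal or meet in a $3$-space; other incidences are containments. A triality map of $V$ is an incidence-preserving permutation of the t.s. points, lines and $4$-spaces that cyclically permutes the set of singular points, the t.s. $4$-spaces of one type, and the t.s. $4$-spaces of the other type. **Theorem.** (i) Every $O^+(8,q)$-space has a triality map. If $q>2$, let $\tau$ be any triality map of an $O^+(8,q)$-space $V$, let $\Omega$ be an ovoid of $V$, and let $a\notin\Omega$ be a singular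 point that is the only singular point in $\langle a^\perp\cap\Omega\rangle^\perp$. Put $\Omega^\bullet=(\Omega\setminus(a^\perp\cap\Omega))\cup\{a\}$. Then $\Sigma^\bullet=(\Omega^\bullet)^\tau$ is a maximal orthogonal partial spread of $V$ of size $q^3-q^2+1$. If moreover $q$ is even, then $\Sigma^\bullet$ is also a maximal symplectic partial spread of $V$ with respect to the polar form of $Q$. (ii) If $q>2$ is even, then every $O^+(8,q)$-space $V$ has such $\tau$, $\Omega$ and $a$, with $\Omega$ a desarguesian ovoid; so $(\Omega^\bullet)^\tau$ is a maximal orthogonal and a maximal symplectic partial spread of $V$ of size $q^3-q^2+1$. Here a desarguesian ovoid is the image, under an isometry onto $V$, of the set of points $\langle(0,0,0,1)\rangle$ and $\langle(1,t,t^{q+q^2},N(t))\rangle$, $t\in F=\mathbb F_{q^3}$, of the $\mathbb F_q$-space $\mathbb F_q\oplus F\oplus F\oplus\mathbb F_q$ with quadratic form $ad+T(\beta\gamma)$ at $(a,\beta,\gamma,d)$, where $T$ and $N$ are the trace and norm $F\to\mathbb F_q$. (iii) For every even $q$ (including $q=2$), every $Sp(8,q)$-space has a maximal symplectic partial spread of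 size $q^3-q^2+1$. -/

import Mathlib

namespace PolarSpread

universe u v w

section General

variable {K : Type u} [Field K] {V : Type v} [AddCommGroup V] [Module K V]

/-- A subspace is totally singular (t.s.) if the quadratic form vanishes on it. -/
def IsTotallySingular (Q : QuadraticForm K V) (W : Submodule K V) : Prop :=
  ∀ x ∈ W, Q x = 0

/-- A subspace is totally isotropic (t.i.) if the bilinear form vanishes on it. -/
def IsTotallyIsotropic (B : LinearMap.BilinForm K V) (W : Submodule K V) : Prop :=
  ∀ x ∈ W, ∀ y ∈ W, B x y = 0

/-- `(V, Q)` is an `O⁺(2n, q)`-space: a nonsingular quadratic space of dimension `2n`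
(the polar form is nondegenerate) that has a totally singular subspace of dimension `n`. -/
structure IsOPlusSpace (n : ℕ) (Q : QuadraticForm K V) : Prop where
  finrank_eq : Module.finrank K V = 2 * n
  nondegenerate : LinearMap.BilinForm.Nondegenerate Q.polarBilin
  exists_totallySingular : ∃ W : Submodule K V, IsTotallySingular Q W ∧ Module.finrank K W = n

/-- `(V, B)` is an `Sp(2n, q)`-space. -/
structure IsSpSpace (n : ℕ) (B : LinearMap.BilinForm K V) : Prop where
  finrank_eq : Module.finrank K V = 2 * n
  isAlt : B.IsAlt
  nondegenerate : LinearMap.BilinForm.Nondegenerate B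

/-- A singular point: a one-dimensional totally singular subspace. -/
def IsSingularPoint (Q : QuadraticForm K V) (p : Submodule K V) : Prop :=
  IsTotallySingular Q p ∧ Module.finrank K p = 1

/-- The subspace `W^⊥`, with respect to the polar form of `Q`. -/
def perp (Q : QuadraticForm K V) (W : Submodule K V) : Submodule K V :=
  LinearMap.BilinForm.orthogonal Q.polarBilin W

/-- A partial ovoid: a set of singular points such that every maximal totally singular
subspace contains at most one of them. -/
def IsPartialOvoid (Q : QuadraticForm K V) (Ω : Set (Submodule K V)) : Prop :=
  (∀ p ∈ Ω, IsSingularPoint Q p) ∧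
    ∀ W : Submodule K V, Maximal (IsTotallySingular Q) W →
      ∀ p ∈ Ω, ∀ p' ∈ Ω, p ≤ W → p' ≤ W → p = p'

/-- An ovoid: a partial ovoid that meets every maximal totally singular subspace. -/
def IsOvoid (Q : QuadraticForm K V) (Ω : Set (Submodule K V)) : Prop :=
  IsPartialOvoid Q Ω ∧
    ∀ W : Submodule K V, Maximal (IsTotallySingular Q) W → ∃ p ∈ Ω, p ≤ W

/-- A partial spread of a `2n`-dimensional space: a set of `n`-dimensional subspaces, any two of
which have only `0` in common. -/
def IsPartialSpread (n : ℕ) (S : Set (Submodule K V)) : Prop :=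
  (∀ W ∈ S, Module.finrank K W = n) ∧ ∀ W ∈ S, ∀ U ∈ S, W ≠ U → W ⊓ U = ⊥

/-- An orthogonal partial spread: a partial spread of totally singular subspaces. -/
def IsOrthogonalPartialSpread (n : ℕ) (Q : QuadraticForm K V) (S : Set (Submodule K V)) : Prop :=
  IsPartialSpread n S ∧ ∀ W ∈ S, IsTotallySingular Q W

/-- A symplectic partial spread: a partial spread of totally isotropic subspaces. -/
def IsSymplecticPartialSpread (n : ℕ) (B : LinearMap.BilinForm K V)
    (S : Set (Submodule K V)) : Prop :=
  IsPartialSpread n S ∧ ∀ W ∈ S, IsTotallyIsotropic B W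

/-- The set `a^⊥ ∩ Ω` of members of `Ω` that are perpendicular to `a`. -/
def perpInter (Q : QuadraticForm K V) (Ω : Set (Submodule K V)) (a : Submodule K V) :
    Set (Submodule K V) :=
  {p ∈ Ω | p ≤ perp Q a}

/-- `a` is a singular point not in `Ω`, and it is the only singular point of
`⟨a^⊥ ∩ Ω⟩^⊥`. -/
structure IsExchangePoint (Q : QuadraticForm K V) (Ω : Set (Submodule K V))
    (a : Submodule K V) : Prop where
  isSingularPoint : IsSingularPoint Q a
  notMem : a ∉ Ω
  unique : ∀ b : Submodule K V, IsSingularPoint Q b →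
    b ≤ perp Q (sSup (perpInter Q Ω a)) → b = a

/-- `Ω^• = (Ω - (a^⊥ ∩ Ω)) ∪ {a}`. -/
def exchange (Q : QuadraticForm K V) (Ω : Set (Submodule K V)) (a : Submodule K V) :
    Set (Submodule K V) :=
  (Ω \ perpInter Q Ω a) ∪ {a}

/-! ### Triality -/

/-- The elements of the triality geometry of an `O⁺(8, q)`-space: the totally singular
points, lines and solids (subspaces of dimension 1, 2 and 4). -/
def Element (Q : QuadraticForm K V) : Type v :=
  {W : Submodule K V // IsTotallySingular Q W ∧
    (Module.finrank K W = 1 ∨ Module.finrank K W = 2 ∨ Module.finrank K W = 4)}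

/-- The dimension of an element. -/
noncomputable def Element.dim {Q : QuadraticForm K V} (x : Element Q) : ℕ :=
  Module.finrank K x.1

/-- Incidence of elements: containment or, for two solids, meeting in a subspace of
dimension 3. -/
def Element.Incident {Q : QuadraticForm K V} (x y : Element Q) : Prop :=
  x.1 ≤ y.1 ∨ y.1 ≤ x.1 ∨
    (x.dim = 4 ∧ y.dim = 4 ∧ Module.finrank K (x.1 ⊓ y.1 : Submodule K V) = 3)

/-- Two totally singular `n`-dimensional subspaces of an `O⁺(2n, q)`-space have the same type if
the dimension of their intersection is congruent to `n` modulo 2. -/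
def SameType (n : ℕ) (W U : Submodule K V) : Prop :=
  Module.finrank K (W ⊓ U : Submodule K V) ≡ n [MOD 2]

/-- A triality map of an `O⁺(8, q)`-space: a permutation of the totally singular points, lines and
solids that preserves incidence and permutes cyclically the singular points, the solids
of one type (that of `M`) and the solids of the other type (so lines go to lines). -/
structure Triality (Q : QuadraticForm K V) where
  toPerm : Equiv.Perm (Element Q)
  incident_iff : ∀ x y : Element Q, (toPerm x).Incident (toPerm y) ↔ x.Incident y
  type_rotation : ∃ M : Element Q, M.dim = 4 ∧ ∀ x : Element Q,
    (x.dim = 1 ↔ (toPerm x).dim = 4 ∧ SameType 4 M.1 (toPerm x).1) ∧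
    ((x.dim = 4 ∧ SameType 4 M.1 x.1) ↔
      (toPerm x).dim = 4 ∧ ¬ SameType 4 M.1 (toPerm x).1) ∧
    ((x.dim = 4 ∧ ¬ SameType 4 M.1 x.1) ↔ (toPerm x).dim = 1)

/-- The image under a triality map of a set of totally singular subspaces. -/
def Triality.image {Q : QuadraticForm K V} (τ : Triality Q) (Ω : Set (Submodule K V)) :
    Set (Submodule K V) :=
  {W | ∃ x : Element Q, x.1 ∈ Ω ∧ (τ.toPerm x).1 = W}

end General

/-! ### The desarguesian ovoid -/

section Desarguesian

variable (K : Type u) [Field K] (F : Type w) [Field F] [Algebra K F]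

/-- The quadratic form `Q(a, β, γ, d) = a d + T(β γ)` on `K ⊕ F ⊕ F ⊕ K`. -/
noncomputable def desarguesianForm : QuadraticForm K (K × F × F × K) :=
  QuadraticMap.linMulLin (LinearMap.fst K K (F × F × K))
      (LinearMap.snd K F K ∘ₗ LinearMap.snd K F (F × K) ∘ₗ LinearMap.snd K K (F × F × K)) +
    (Algebra.trace K F).compQuadraticMap
      (QuadraticMap.linMulLin
        (LinearMap.fst K F (F × K) ∘ₗ LinearMap.snd K K (F × F × K))
        (LinearMap.fst K F K ∘ₗ LinearMap.snd K F (F × K) ∘ₗ LinearMap.snd K K (F × F × K)))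

theorem desarguesianForm_apply (a d : K) (β γ : F) :
    desarguesianForm K F (a, β, γ, d) = a * d + Algebra.trace K F (β * γ) := by
  simp [desarguesianForm]

/-- The points `⟨(0, 0, 0, 1)⟩` and `⟨(1, t, t^(q + q²), N(t))⟩` for `t ∈ F`, where `q = |K|`. -/
noncomputable def desarguesianPoints : Set (Submodule K (K × F × F × K)) :=
  {Submodule.span K {((0 : K), (0 : F), (0 : F), (1 : K))}} ∪
    Set.range fun t : F => Submodule.span K
      {((1 : K), t, t ^ (Nat.card K + Nat.card K ^ 2), Algebra.norm K t)}

variable {K} {V : Type v} [AddCommGroup V] [Module K V]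

/-- `Ω` is a desarguesian ovoid of `(V, Q)`: for a cubic extension `F` of `K`, it is the image
of the set of points above under an isometry from `K ⊕ F ⊕ F ⊕ K` to `V`. -/
def IsDesarguesianOvoid (Q : QuadraticForm K V) (Ω : Set (Submodule K V)) : Prop :=
  ∃ (F : Type u) (_ : Field F) (_ : Algebra K F),
    Module.finrank K F = 3 ∧
      ∃ e : (desarguesianForm K F).IsometryEquiv Q,
        Ω = Submodule.map (e.toLinearEquiv : (K × F × F × K) →ₗ[K] V) '' desarguesianPoints K F

end Desarguesian

end PolarSpread

/-! Identify the `O⁺(8, q)`-space with an eight-dimensional symmetric composition algebra: the left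
and the right annihilators of singular vectors are the solids of the two types, and passing from a
point to an annihilator is a triality.

A triality turns perpendicular points into solids that meet nontrivially. So it maps (partial)
ovoids to (partial) spreads, and counting the singular vectors covered by a spread shows that an
ovoid `Ω` has `q³ + 1` points, of which `q² + 1` are perpendicular to a singular point `a ∉ Ω`. If
`b` is perpendicular to no point of `Ω^•`, then `b^⊥ ∩ Ω` is contained in `a^⊥ ∩ Ω`; both have
`q² + 1` members, so they coincide and `b = a`. Hence `Ω^•` is a maximal partial ovoid, and its
image is a maximal partial spread. In characteristic 2 the singular vectors of a totally isotropic
solid form a subspace of codimension at most 1. If this is a 3-space `H`, a totally singular solid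
through `H` of the type of the image spread meets some member of it in dimension 2 or more, and so
does `H` in dimension 1 or more; that gives symplectic maximality.

For the desarguesian ovoid take `a = ⟨(0, β, 0, 0)⟩` with `T(β) = T(β θ) = 0`, where `θ` generates
`F`. For `q = 2` every singular point outside any ovoid will do: representatives of all but one
point of the ovoid form a basis of `V`, so `a^⊥ ∩ Ω` determines `a`. -/

namespace PolarSpread

open Module Submodule

universe u v w

section SingularSubspaces

variable {K : Type u} [Field K] {V : Type v} [AddCommGroup V] [Module K V]
  {Q : QuadraticForm K V} {W U X : Submodule K V} {n : ℕ}

theorem map_add_polarBilin (Q : QuadraticForm K V) (x y : V) :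
    Q (x + y) = Q x + Q y + Q.polarBilin x y :=
  QuadraticMap.map_add Q x y

theorem polarBilin_comm (Q : QuadraticForm K V) (x y : V) :
    Q.polarBilin x y = Q.polarBilin y x :=
  QuadraticMap.polar_comm Q x y

theorem polarBilin_isRefl (Q : QuadraticForm K V) : Q.polarBilin.IsRefl := fun x y h => by
  rwa [polarBilin_comm]

theorem mem_perp_span_singleton {x y : V} :
    x ∈ perp Q (span K {y}) ↔ Q.polarBilin y x = 0 := by
  refine ⟨fun h => h y (mem_span_singleton_self y), fun h z hz => ?_⟩
  obtain ⟨c, rfl⟩ := mem_span_singleton.1 hz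
  rw [map_smul, LinearMap.smul_apply, h, smul_zero]

theorem perp_anti (h : W ≤ U) : perp Q U ≤ perp Q W :=
  LinearMap.BilinForm.orthogonal_le h

theorem le_perp_comm : W ≤ perp Q U ↔ U ≤ perp Q W := by
  constructor <;> exact fun h x hx y hy => by
    rw [polarBilin_comm]; exact h hy x hx

theorem perp_sup : perp Q (W ⊔ U) = perp Q W ⊓ perp Q U := by
  refine le_antisymm (le_inf (perp_anti le_sup_left) (perp_anti le_sup_right)) ?_
  rw [le_perp_comm, sup_le_iff]
  exact ⟨le_perp_comm.1 inf_le_left, le_perp_comm.1 inf_le_right⟩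

theorem IsTotallySingular.mono (hU : IsTotallySingular Q U) (h : W ≤ U) :
    IsTotallySingular Q W := fun x hx => hU x (h hx)

theorem IsTotallySingular.polarBilin_eq_zero (hW : IsTotallySingular Q W) {x y : V} (hx : x ∈ W)
    (hy : y ∈ W) : Q.polarBilin x y = 0 := by
  have h := map_add_polarBilin Q x y
  rwa [hW _ hx, hW _ hy, hW _ (add_mem hx hy), zero_add, zero_add, eq_comm] at h

theorem IsTotallySingular.le_perp (hW : IsTotallySingular Q W) : W ≤ perp Q W :=
  fun _ hx _ hy => hW.polarBilin_eq_zero hy hx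

theorem IsTotallySingular.sup (hW : IsTotallySingular Q W) (hU : IsTotallySingular Q U)
    (h : U ≤ perp Q W) : IsTotallySingular Q (W ⊔ U) := by
  intro z hz
  obtain ⟨x, hx, y, hy, rfl⟩ := mem_sup.1 hz
  rw [map_add_polarBilin, hW x hx, hU y hy, h hy x hx, zero_add, zero_add]

theorem isTotallySingular_span_singleton {x : V} (hx : Q x = 0) :
    IsTotallySingular Q (span K {x}) := by
  intro y hy
  obtain ⟨c, rfl⟩ := mem_span_singleton.1 hy
  rw [QuadraticMap.map_smul, hx, smul_zero]

theorem isSingularPoint_iff {p : Submodule K V} :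
    IsSingularPoint Q p ↔ ∃ x : V, x ≠ 0 ∧ Q x = 0 ∧ p = span K {x} := by
  constructor
  · rintro ⟨hp, hp1⟩
    have : FiniteDimensional K p := Module.finite_of_finrank_pos (by rw [hp1]; exact one_pos)
    obtain ⟨x, hx, hx0⟩ := p.ne_bot_iff.1 (by rintro rfl; simp at hp1)
    have hle : span K {x} ≤ p := (span_singleton_le_iff_mem x p).2 hx
    exact ⟨x, hx0, hp x hx,
      (eq_of_le_of_finrank_eq hle (by rw [finrank_span_singleton hx0, hp1])).symm⟩
  · rintro ⟨x, hx, hQ, rfl⟩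
    exact ⟨isTotallySingular_span_singleton hQ, finrank_span_singleton hx⟩

/-- A generator of a quadratic space of dimension `2n`: a totally singular subspace of
dimension `n`. In an `O⁺(2n, q)`-space these are the maximal totally singular subspaces. -/
structure IsGenerator (n : ℕ) (Q : QuadraticForm K V) (W : Submodule K V) : Prop where
  isTotallySingular : IsTotallySingular Q W
  finrank_eq : finrank K W = n

variable [FiniteDimensional K V]

theorem finrank_inf_add_finrank_sup (W U : Submodule K V) :
    finrank K (W ⊓ U : Submodule K V) + finrank K (W ⊔ U : Submodule K V) =
      finrank K W + finrank K U := by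
  rw [add_comm, finrank_sup_add_finrank_inf_eq]

theorem sup_span_singleton_eq_of_finrank_add_one {y : V} (hWU : W ≤ U)
    (hfinrank : finrank K W + 1 = finrank K U) (hyU : y ∈ U) (hyW : y ∉ W) :
    W ⊔ span K {y} = U := by
  have hlt : W < W ⊔ span K {y} := by
    rw [left_lt_sup, span_singleton_le_iff_mem]
    exact hyW
  refine eq_of_le_of_finrank_le (sup_le hWU ((span_singleton_le_iff_mem y U).2 hyU)) ?_
  have := finrank_lt_finrank_of_lt hlt
  omega

theorem perp_perp (hQ : LinearMap.BilinForm.Nondegenerate Q.polarBilin) (W : Submodule K V) :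
    perp Q (perp Q W) = W :=
  LinearMap.BilinForm.orthogonal_orthogonal hQ (polarBilin_isRefl Q) W

theorem perp_inf (hQ : LinearMap.BilinForm.Nondegenerate Q.polarBilin) (W U : Submodule K V) :
    perp Q (W ⊓ U) = perp Q W ⊔ perp Q U := by
  rw [← perp_perp hQ (perp Q W ⊔ perp Q U), perp_sup, perp_perp hQ, perp_perp hQ]

theorem exists_maximal_isTotallySingular_ge (hW : IsTotallySingular Q W) :
    ∃ U, W ≤ U ∧ Maximal (IsTotallySingular Q) U :=
  exists_maximal_ge_of_wellFoundedGT _ _ hW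

namespace IsOPlusSpace

theorem finrank_perp (h : IsOPlusSpace n Q) (W : Submodule K V) :
    finrank K W + finrank K (perp Q W) = 2 * n := by
  have hperp := LinearMap.BilinForm.finrank_orthogonal h.nondegenerate W
  have hle := finrank_le W
  rw [h.finrank_eq] at hperp hle
  unfold perp
  omega

theorem finrank_le (h : IsOPlusSpace n Q) (hW : IsTotallySingular Q W) : finrank K W ≤ n := by
  have := h.finrank_perp W
  have := finrank_mono hW.le_perp
  omega

theorem perp_eq_self (h : IsOPlusSpace n Q) (hW : IsGenerator n Q W) : perp Q W = W := by
  have := h.finrank_perp W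
  have := hW.finrank_eq
  exact (eq_of_le_of_finrank_le hW.isTotallySingular.le_perp (by omega)).symm

theorem finrank_inf_perp (h : IsOPlusSpace n Q) (hU : IsGenerator n Q U) (W : Submodule K V) :
    finrank K (U ⊓ perp Q W : Submodule K V) + finrank K W =
      finrank K (U ⊓ W : Submodule K V) + n := by
  have hsup := h.finrank_perp (U ⊓ W)
  rw [perp_inf h.nondegenerate, h.perp_eq_self hU] at hsup
  have := finrank_inf_add_finrank_sup U (perp Q W)
  have := h.finrank_perp W
  have := hU.finrank_eq
  omega

theorem isGenerator_sup_inf_perp (h : IsOPlusSpace n Q) (hW : IsTotallySingular Q W)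
    (hU : IsGenerator n Q U) : IsGenerator n Q (W ⊔ U ⊓ perp Q W) := by
  refine ⟨hW.sup (hU.isTotallySingular.mono inf_le_left) inf_le_right, ?_⟩
  have hinf : W ⊓ (U ⊓ perp Q W) = U ⊓ W := by
    rw [inf_left_comm, inf_eq_left.2 hW.le_perp]
  have hsup := finrank_inf_add_finrank_sup W (U ⊓ perp Q W)
  rw [hinf] at hsup
  have := h.finrank_inf_perp hU W
  omega

theorem maximal_iff (h : IsOPlusSpace n Q) :
    Maximal (IsTotallySingular Q) W ↔ IsGenerator n Q W := by
  constructor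
  · intro hW
    obtain ⟨U, hU, hUn⟩ := h.exists_totallySingular
    have hgen := h.isGenerator_sup_inf_perp hW.prop ⟨hU, hUn⟩
    rwa [← hW.eq_of_le hgen.isTotallySingular le_sup_left] at hgen
  · refine fun hW => ⟨hW.isTotallySingular, fun U hU hWU => ?_⟩
    rw [eq_of_le_of_finrank_le hWU (hW.finrank_eq ▸ h.finrank_le hU)]

/-- `W` lies in `(U ⊓ X)^⊥ = U ⊔ X`, and a singular vector of `U ⊔ X` lies in `U` or in `X`. -/
theorem eq_or_eq_of_inf_le (h : IsOPlusSpace n Q) (hU : IsGenerator n Q U)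
    (hX : IsGenerator n Q X) (hW : IsGenerator n Q W)
    (hUX : finrank K (U ⊓ X : Submodule K V) + 1 = n) (hle : U ⊓ X ≤ W) : W = U ∨ W = X := by
  have hWsup : W ≤ U ⊔ X := by
    rw [← h.perp_eq_self hU, ← h.perp_eq_self hX, ← perp_inf h.nondegenerate,
      ← h.perp_eq_self hW]
    exact perp_anti hle
  have hsubset : (W : Set V) ⊆ U ∪ X := by
    intro w hw
    obtain ⟨y, hy, x, hx, rfl⟩ := mem_sup.1 (hWsup hw)
    have hyx : Q.polarBilin y x = 0 := by
      have := map_add_polarBilin Q y x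
      rwa [hW.isTotallySingular _ hw, hU.isTotallySingular _ hy, hX.isTotallySingular _ hx,
        zero_add, zero_add, eq_comm] at this
    by_cases hyX : y ∈ X
    · exact Or.inr (add_mem hyX hx)
    have hsup : U ⊓ X ⊔ span K {y} = U :=
      sup_span_singleton_eq_of_finrank_add_one inf_le_left (hUX.trans hU.finrank_eq.symm) hy
        fun hyUX => hyX hyUX.2
    have hxU : x ∈ U := by
      rw [← h.perp_eq_self hU, ← hsup, perp_sup]
      exact ⟨fun z hz => hX.isTotallySingular.polarBilin_eq_zero hz.2 hx,
        mem_perp_span_singleton.2 hyx⟩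
    exact Or.inl (add_mem hy hxU)
  refine (AddSubgroupClass.subset_union.1 hsubset).imp (fun hWU => ?_) fun hWX => ?_
  · exact eq_of_le_of_finrank_eq hWU (hW.finrank_eq.trans hU.finrank_eq.symm)
  · exact eq_of_le_of_finrank_eq hWX (hW.finrank_eq.trans hX.finrank_eq.symm)

theorem finrank_inf_eq_add_one_of_inf_perp_le (h : IsOPlusSpace n Q) (hU : IsGenerator n Q U)
    (hX : IsGenerator n Q X) (hW : IsGenerator n Q W)
    (hUX : finrank K (U ⊓ X : Submodule K V) + 1 = n) (hle : W ⊓ perp Q (U ⊓ X) ≤ U) :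
    finrank K (W ⊓ U : Submodule K V) = finrank K (W ⊓ X : Submodule K V) + 1 := by
  have hU' : U ≤ perp Q (U ⊓ X) := (h.perp_eq_self hU).ge.trans (perp_anti inf_le_left)
  have hX' : X ≤ perp Q (U ⊓ X) := (h.perp_eq_self hX).ge.trans (perp_anti inf_le_right)
  have hWU : W ⊓ perp Q (U ⊓ X) = W ⊓ U :=
    le_antisymm (le_inf inf_le_left hle) (inf_le_inf_left W hU')
  have hWX : W ⊓ (U ⊓ X) = W ⊓ X :=
    le_antisymm (inf_le_inf_left W inf_le_right) <| le_inf inf_le_left <|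
      le_inf ((inf_le_inf_left W hX').trans hle) inf_le_right
  have hfinrank := h.finrank_inf_perp hW (U ⊓ X)
  rw [hWU, hWX] at hfinrank
  omega

theorem finrank_inf_of_adjacent (h : IsOPlusSpace n Q) (hU : IsGenerator n Q U)
    (hX : IsGenerator n Q X) (hW : IsGenerator n Q W)
    (hUX : finrank K (U ⊓ X : Submodule K V) + 1 = n) :
    finrank K (W ⊓ U : Submodule K V) = finrank K (W ⊓ X : Submodule K V) + 1 ∨
      finrank K (W ⊓ X : Submodule K V) = finrank K (W ⊓ U : Submodule K V) + 1 := by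
  have hgen := h.isGenerator_sup_inf_perp (hU.isTotallySingular.mono (inf_le_left (b := X))) hW
  refine (h.eq_or_eq_of_inf_le hU hX hgen hUX le_sup_left).imp (fun heq => ?_) fun heq => ?_
  · exact h.finrank_inf_eq_add_one_of_inf_perp_le hU hX hW hUX (le_sup_right.trans heq.le)
  · rw [inf_comm] at hUX heq
    exact h.finrank_inf_eq_add_one_of_inf_perp_le hX hU hW hUX (le_sup_right.trans heq.le)

theorem exists_adjacent_mem (h : IsOPlusSpace n Q) (hX : IsGenerator n Q X) {x : V} (hx : Q x = 0)
    (hxX : x ∉ X) : ∃ Y, IsGenerator n Q Y ∧ x ∈ Y ∧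
      finrank K (Y ⊓ X : Submodule K V) + 1 = n ∧ X ⊓ perp Q (span K {x}) ≤ Y := by
  have hx0 : x ≠ 0 := fun h0 => hxX (h0 ▸ X.zero_mem)
  have hY := h.isGenerator_sup_inf_perp (isTotallySingular_span_singleton (K := K) hx) hX
  have hxY : x ∈ span K {x} ⊔ X ⊓ perp Q (span K {x}) :=
    mem_sup_left (mem_span_singleton_self x)
  refine ⟨_, hY, hxY, ?_, le_sup_right⟩
  have hinf : X ⊓ span K {x} = ⊥ := ((disjoint_span_singleton' hx0).2 hxX).eq_bot
  have hperp := h.finrank_inf_perp hX (span K {x})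
  rw [hinf, finrank_bot, finrank_span_singleton hx0] at hperp
  have hge := finrank_mono (le_inf (le_sup_right (a := span K {x})) inf_le_left :
    X ⊓ perp Q (span K {x}) ≤ (span K {x} ⊔ X ⊓ perp Q (span K {x})) ⊓ X)
  have hlt := finrank_lt_finrank_of_lt (inf_lt_left.2 fun hle => hxX (hle hxY))
  rw [hY.finrank_eq] at hlt
  omega

theorem exists_adjacent_closer (h : IsOPlusSpace n Q) (hU : IsGenerator n Q U)
    (hX : IsGenerator n Q X) (hne : U ≠ X) :
    ∃ Y, IsGenerator n Q Y ∧ finrank K (Y ⊓ X : Submodule K V) + 1 = n ∧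
      finrank K (U ⊓ Y : Submodule K V) = finrank K (U ⊓ X : Submodule K V) + 1 := by
  obtain ⟨x, hx, hxX⟩ : ∃ x ∈ U, x ∉ X := SetLike.not_le_iff_exists.1 fun hle =>
    hne (eq_of_le_of_finrank_eq hle (hU.finrank_eq.trans hX.finrank_eq.symm))
  obtain ⟨Y, hY, -, hYX, hle⟩ := h.exists_adjacent_mem hX (hU.isTotallySingular x hx) hxX
  refine ⟨Y, hY, hYX, ?_⟩
  have hUX : U ⊓ X ≤ U ⊓ Y := by
    refine le_inf inf_le_left (le_trans (le_inf inf_le_right fun z hz => ?_) hle)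
    exact mem_perp_span_singleton.2 (hU.isTotallySingular.polarBilin_eq_zero hx hz.1)
  have := finrank_mono hUX
  rcases h.finrank_inf_of_adjacent hY hX hU hYX with hgt | hlt <;> omega

theorem adjacent_induction (h : IsOPlusSpace n Q) {P : Submodule K V → Prop}
    (hX : IsGenerator n Q X) (hP : P X)
    (step : ∀ Y Z : Submodule K V, IsGenerator n Q Y → IsGenerator n Q Z →
      finrank K (Z ⊓ Y : Submodule K V) + 1 = n → P Y → P Z)
    (hU : IsGenerator n Q U) : P U := by
  have hUn := hU.finrank_eq
  induction hk : n - finrank K (U ⊓ X : Submodule K V) generalizing X with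
  | zero =>
    have hle : U ⊓ X = U := eq_of_le_of_finrank_le inf_le_left (by omega)
    rwa [eq_of_le_of_finrank_eq (inf_eq_left.1 hle) (hUn.trans hX.finrank_eq.symm)]
  | succ k ih =>
    have hne : U ≠ X := by
      rintro rfl
      rw [inf_idem] at hk
      omega
    obtain ⟨Y, hY, hYX, hUY⟩ := h.exists_adjacent_closer hU hX hne
    exact ih hY (step X Y hX hY hYX hP) (by omega)

theorem finrank_inf_add_mod_two (h : IsOPlusSpace n Q) (hU : IsGenerator n Q U)
    (hX : IsGenerator n Q X) (hW : IsGenerator n Q W) :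
    (finrank K (W ⊓ U : Submodule K V) + finrank K (W ⊓ X : Submodule K V) +
      finrank K (U ⊓ X : Submodule K V)) % 2 = n % 2 := by
  refine h.adjacent_induction (P := fun Y => (finrank K (W ⊓ Y : Submodule K V) +
    finrank K (W ⊓ X : Submodule K V) + finrank K (Y ⊓ X : Submodule K V)) % 2 = n % 2)
    hX ?_ (fun Y Z hY hZ hZY hP => ?_) hU
  · have := hX.finrank_eq
    rw [inf_idem]
    omega
  · have hW' := h.finrank_inf_of_adjacent hZ hY hW hZY
    have hX' := h.finrank_inf_of_adjacent hZ hY hX hZY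
    rw [inf_comm X Z, inf_comm X Y] at hX'
    omega

end IsOPlusSpace

end SingularSubspaces

section HyperbolicCoordinates

variable {K : Type u} [Field K] {V : Type v} [AddCommGroup V] [Module K V]
  [FiniteDimensional K V] {n : ℕ}

theorem exists_dualEquiv_of_isTotallyIsotropic {B : LinearMap.BilinForm K V}
    (hB : B.Nondegenerate) {W U : Submodule K V} (hW : IsTotallyIsotropic B W) (hWU : IsCompl W U)
    (hfinrank : finrank K W = finrank K U) :
    ∃ φ : W ≃ₗ[K] Dual K U, ∀ w u, φ w u = B w u := by
  let φ : W →ₗ[K] Dual K U := B.domRestrict₁₂ W U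
  have hφ : Function.Injective φ := by
    refine (injective_iff_map_eq_zero φ).2 fun w hw => Subtype.ext (hB.1 w fun v => ?_)
    obtain ⟨w', hw', u, hu, rfl⟩ := mem_sup.1 (hWU.sup_eq_top ▸ mem_top : v ∈ W ⊔ U)
    have hwu : B w u = 0 := LinearMap.congr_fun hw ⟨u, hu⟩
    rw [map_add, hW w w.2 w' hw', hwu, zero_add]
  exact ⟨LinearEquiv.ofInjectiveOfFinrankEq φ hφ
    (hfinrank.trans Subspace.dual_finrank_eq.symm), fun _ _ => rfl⟩

namespace IsOPlusSpace

variable {Q : QuadraticForm K V} {W : Submodule K V}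

/-- Write `Q` on an arbitrary complement `U` of `W` as `u ↦ A(u, u)` with `A` bilinear; then the
graph of the map `f : U → W` with `B(f u, u') = -A(u, u')` is totally singular. -/
theorem exists_isCompl_isGenerator (h : IsOPlusSpace n Q) (hW : IsGenerator n Q W) :
    ∃ U, IsGenerator n Q U ∧ IsCompl W U := by
  obtain ⟨U, hWU⟩ := Submodule.exists_isCompl W
  have hUn : finrank K U = n := by
    have := finrank_add_eq_of_isCompl hWU
    have := h.finrank_eq
    have := hW.finrank_eq
    omega
  obtain ⟨φ, hφ⟩ := exists_dualEquiv_of_isTotallyIsotropic h.nondegenerate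
    (fun _ hx _ hy => hW.isTotallySingular.polarBilin_eq_zero hx hy) hWU
    (hW.finrank_eq.trans hUn.symm)
  obtain ⟨A, hA⟩ := LinearMap.BilinMap.toQuadraticMap_surjective (Q.comp U.subtype)
  let f : U →ₗ[K] W := -(φ.symm.toLinearMap ∘ₗ A)
  have hf (u : U) : Q.polarBilin (f u) u = -Q u := by
    have hAu : A u u = Q u := DFunLike.congr_fun hA u
    rw [← hφ, LinearMap.neg_apply, map_neg, LinearMap.neg_apply, LinearMap.comp_apply,
      LinearEquiv.coe_coe, φ.apply_symm_apply, hAu]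
  let g : U →ₗ[K] V := W.subtype ∘ₗ f + U.subtype
  have hgW (u : U) (hu : g u ∈ W) : u = 0 := by
    have huW : (u : V) ∈ W := (add_mem_cancel_left (f u).2).1 hu
    exact Subtype.ext (disjoint_def.1 hWU.disjoint _ huW u.2)
  have hg : Function.Injective g :=
    (injective_iff_map_eq_zero g).2 fun u hu => hgW u (hu ▸ W.zero_mem)
  have hrange : finrank K (LinearMap.range g) = n := by
    rw [LinearMap.finrank_range_of_inj hg, hUn]
  have hdisjoint : Disjoint W (LinearMap.range g) := by
    rw [disjoint_def]
    rintro _ hv ⟨u, rfl⟩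
    rw [hgW u hv, map_zero]
  refine ⟨LinearMap.range g, ⟨?_, hrange⟩, (isCompl_iff_disjoint _ _ ?_).2 hdisjoint⟩
  · rintro _ ⟨u, rfl⟩
    change Q (f u + u) = 0
    rw [map_add_polarBilin, hW.isTotallySingular _ (f u).2, hf, zero_add, add_neg_cancel]
  · rw [h.finrank_eq, hrange, hW.finrank_eq, two_mul]

theorem exists_coordinates (h : IsOPlusSpace n Q) :
    ∃ e : ((Fin n → K) × (Fin n → K)) ≃ₗ[K] V, ∀ x y, Q (e (x, y)) = x ⬝ᵥ y := by
  obtain ⟨W, hW, hWn⟩ := h.exists_totallySingular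
  obtain ⟨U, hU, hWU⟩ := h.exists_isCompl_isGenerator ⟨hW, hWn⟩
  obtain ⟨φ, hφ⟩ := exists_dualEquiv_of_isTotallyIsotropic h.nondegenerate
    (fun _ hx _ hy => hW.polarBilin_eq_zero hx hy) hWU (hWn.trans hU.finrank_eq.symm)
  let b := finBasisOfFinrankEq K U hU.finrank_eq
  let c := b.dualBasis.equivFun.symm ≪≫ₗ φ.symm
  have hcb (x y : Fin n → K) : Q.polarBilin (c x) (b.equivFun.symm y) = x ⬝ᵥ y := by
    rw [← hφ, LinearEquiv.trans_apply, φ.apply_symm_apply]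
    simp [Basis.equivFun_symm_apply, dotProduct, Finsupp.single_apply, mul_comm]
  refine ⟨(c.prodCongr b.equivFun.symm).trans (prodEquivOfIsCompl W U hWU), fun x y => ?_⟩
  rw [LinearEquiv.trans_apply, LinearEquiv.prodCongr_apply, coe_prodEquivOfIsCompl',
    map_add_polarBilin, hW _ (c x).2, hU.isTotallySingular _ (b.equivFun.symm y).2, hcb,
    zero_add, zero_add]

end IsOPlusSpace

end HyperbolicCoordinates

section SymplecticForms

variable {K : Type u} [Field K] {V : Type v} [AddCommGroup V] [Module K V]
  {n : ℕ} {B : LinearMap.BilinForm K V}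

theorem IsTotallyIsotropic.sup_span_singleton (hB : B.IsAlt) {W : Submodule K V}
    (hW : IsTotallyIsotropic B W) {x : V} (hx : x ∈ B.orthogonal W) :
    IsTotallyIsotropic B (W ⊔ span K {x}) := by
  intro y hy z hz
  obtain ⟨w, hw, _, hc, rfl⟩ := mem_sup.1 hy
  obtain ⟨w', hw', _, hd, rfl⟩ := mem_sup.1 hz
  obtain ⟨c, rfl⟩ := mem_span_singleton.1 hc
  obtain ⟨d, rfl⟩ := mem_span_singleton.1 hd
  have hwx : B w x = 0 := hx w hw
  have hxw : B x w' = 0 := hB.isRefl _ _ (hx w' hw')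
  simp [hW w hw w' hw', hwx, hxw, hB x]

variable [FiniteDimensional K V]

theorem IsSpSpace.exists_isTotallyIsotropic (h : IsSpSpace n B) :
    ∃ W : Submodule K V, IsTotallyIsotropic B W ∧ finrank K W = n := by
  have hbot : IsTotallyIsotropic B (⊥ : Submodule K V) := by
    intro x hx y _
    rw [(mem_bot K).1 hx, map_zero, LinearMap.zero_apply]
  obtain ⟨W, -, hW⟩ := exists_maximal_ge_of_wellFoundedGT (IsTotallyIsotropic B) ⊥ hbot
  have hle : W ≤ B.orthogonal W := fun x hx y hy => hW.prop y hy x hx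
  have hge : B.orthogonal W ≤ W := fun x hx =>
    hW.le_of_ge (hW.prop.sup_span_singleton h.isAlt hx) le_sup_left
      (mem_sup_right (mem_span_singleton_self x))
  have hfinrank := LinearMap.BilinForm.finrank_orthogonal h.nondegenerate W
  rw [hge.antisymm hle, h.finrank_eq] at hfinrank
  have := finrank_le W
  exact ⟨W, hW.prop, by have := h.finrank_eq; omega⟩

theorem exists_quadraticForm_of_isAlt [CharP K 2] (hB : B.IsAlt) :
    ∃ Q : QuadraticForm K V, Q.polarBilin = B := by
  let b := finBasis K V
  let A : LinearMap.BilinForm K V :=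
    b.constr K fun i => b.constr K fun j => if i < j then B (b i) (b j) else 0
  refine ⟨LinearMap.BilinMap.toQuadraticMap A, b.ext fun i => b.ext fun j => ?_⟩
  rw [LinearMap.BilinMap.polarBilin_toQuadraticMap]
  simp only [LinearMap.add_apply, LinearMap.flip_apply, A, Basis.constr_basis]
  rcases lt_trichotomy i j with hij | rfl | hij
  · rw [if_pos hij, if_neg hij.not_gt, add_zero]
  · rw [if_neg (lt_irrefl i), hB, add_zero]
  · rw [if_neg hij.not_gt, if_pos hij, zero_add, ← hB.neg_eq, CharTwo.neg_eq]

/-- Given a totally isotropic `W` of dimension `n` and a complement `U`, take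
`w + u ↦ B(w, u) + Q₀(u)` for any quadratic form `Q₀` with polar form `B`. -/
theorem IsSpSpace.exists_quadraticForm [CharP K 2] (h : IsSpSpace n B) :
    ∃ Q : QuadraticForm K V, Q.polarBilin = B ∧ IsOPlusSpace n Q := by
  obtain ⟨W, hW, hWn⟩ := h.exists_isTotallyIsotropic
  obtain ⟨U, hWU⟩ := Submodule.exists_isCompl W
  obtain ⟨Q₀, hQ₀⟩ := exists_quadraticForm_of_isAlt h.isAlt
  let πW := W.projection U hWU
  let πU := U.projection W hWU.symm
  let Q : QuadraticForm K V :=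
    LinearMap.BilinMap.toQuadraticMap (B.compl₁₂ πW πU) + Q₀.comp πU
  have hQ : Q.polarBilin = B := by
    ext x y
    have hx : πW x + πU x = x := projection_add_projection_eq_self hWU x
    have hy : πW y + πU y = y := projection_add_projection_eq_self hWU y
    have hWW : B (πW x) (πW y) = 0 :=
      hW _ (projection_apply_mem hWU x) _ (projection_apply_mem hWU y)
    have hcomm : B (πW y) (πU x) = B (πU x) (πW y) := by rw [← h.isAlt.neg_eq, CharTwo.neg_eq]
    calc Q.polarBilin x y
        = B (πW x) (πU y) + B (πW y) (πU x) + Q₀.polarBilin (πU x) (πU y) := by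
          rw [QuadraticMap.polarBilin_apply_apply, FunLike.coe_add, QuadraticMap.polar_add,
            LinearMap.BilinMap.polar_toQuadraticMap]
          simp [QuadraticMap.polar]
      _ = B (πW x + πU x) (πW y + πU y) := by
          rw [hQ₀, hcomm, map_add, map_add, LinearMap.add_apply, LinearMap.add_apply, hWW]
          ring
      _ = B x y := by rw [hx, hy]
  refine ⟨Q, hQ, h.finrank_eq, hQ ▸ h.nondegenerate, W, fun w hw => ?_, hWn⟩
  have hπU : πU w = 0 := (projection_apply_eq_zero_iff hWU.symm).2 hw
  simp [Q, hπU]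

theorem charP_two_of_even_card [Finite K] (h : Even (Nat.card K)) : CharP K 2 := by
  have := Fintype.ofFinite K
  rw [Nat.card_eq_fintype_card] at h
  exact ringChar.eq_iff.1 (FiniteField.even_card_iff_char_two.2 (Nat.even_iff.1 h))

end SymplecticForms

section SymmetricComposition

open LinearMap (ker range)

open scoped Matrix

variable {K : Type u} [Field K] {V : Type v} [AddCommGroup V] [Module K V]
  {Q : QuadraticForm K V} {m : V →ₗ[K] V →ₗ[K] V} {x y : V}

/-- A symmetric composition algebra with norm form `Q` and multiplication `m`, written as
`x * y = m x y`: the identities are `(x * y) * x = Q(x) y = x * (y * x)` and the associativity of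
the polar form. The flip of `m` is again such a multiplication. -/
structure IsSymmetricComposition (Q : QuadraticForm K V) (m : V →ₗ[K] V →ₗ[K] V) : Prop where
  left : ∀ x y, m (m x y) x = Q x • y
  right : ∀ x y, m x (m y x) = Q x • y
  assoc : ∀ x y z, Q.polarBilin (m x y) z = Q.polarBilin x (m y z)

/-- The multiplication of the split para-octonions, a symmetric composition on `K⁴ ⊕ K⁴` with norm
form `(u, v) ↦ u ⬝ᵥ v`. It is `x * y = x̄ ȳ` in Zorn's algebra of vector matrices, whose product on
`K ⊕ K³ ⊕ K³ ⊕ K` combines the dot product and the cross product of `K³`: the first components of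
`u` and `v` are the two diagonal entries, and the sign of one off-diagonal entry is changed. -/
def paraOctonionMul (K : Type u) [Field K] :
    ((Fin 4 → K) × (Fin 4 → K)) →ₗ[K] ((Fin 4 → K) × (Fin 4 → K)) →ₗ[K]
      ((Fin 4 → K) × (Fin 4 → K)) :=
  LinearMap.mk₂ K
    (fun x y =>
      (![x.2 0 * y.2 0 - (x.1 1 * y.2 1 + x.1 2 * y.2 2 + x.1 3 * y.2 3),
         -(x.2 0 * y.1 1) - y.1 0 * x.1 1 - (x.2 2 * y.2 3 - x.2 3 * y.2 2),
         -(x.2 0 * y.1 2) - y.1 0 * x.1 2 - (x.2 3 * y.2 1 - x.2 1 * y.2 3),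
         -(x.2 0 * y.1 3) - y.1 0 * x.1 3 - (x.2 1 * y.2 2 - x.2 2 * y.2 1)],
       ![x.1 0 * y.1 0 - (x.2 1 * y.1 1 + x.2 2 * y.1 2 + x.2 3 * y.1 3),
         -(y.2 0 * x.2 1) - x.1 0 * y.2 1 - (x.1 2 * y.1 3 - x.1 3 * y.1 2),
         -(y.2 0 * x.2 2) - x.1 0 * y.2 2 - (x.1 3 * y.1 1 - x.1 1 * y.1 3),
         -(y.2 0 * x.2 3) - x.1 0 * y.2 3 - (x.1 1 * y.1 2 - x.1 2 * y.1 1)]))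
    (fun x x' y => by ext i <;> fin_cases i <;> simp <;> ring)
    (fun c x y => by ext i <;> fin_cases i <;> simp <;> ring)
    (fun x y y' => by ext i <;> fin_cases i <;> simp <;> ring)
    (fun c x y => by ext i <;> fin_cases i <;> simp <;> ring)

theorem paraOctonionMul_left (x y : (Fin 4 → K) × (Fin 4 → K)) :
    paraOctonionMul K (paraOctonionMul K x y) x = (x.1 ⬝ᵥ x.2) • y := by
  ext i <;> fin_cases i <;> simp [paraOctonionMul, dotProduct, Fin.sum_univ_four] <;> ring

theorem paraOctonionMul_right (x y : (Fin 4 → K) × (Fin 4 → K)) :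
    paraOctonionMul K x (paraOctonionMul K y x) = (x.1 ⬝ᵥ x.2) • y := by
  ext i <;> fin_cases i <;> simp [paraOctonionMul, dotProduct, Fin.sum_univ_four] <;> ring

theorem paraOctonionMul_assoc (x y z : (Fin 4 → K) × (Fin 4 → K)) :
    (paraOctonionMul K x y).1 ⬝ᵥ z.2 + z.1 ⬝ᵥ (paraOctonionMul K x y).2 =
      x.1 ⬝ᵥ (paraOctonionMul K y z).2 + (paraOctonionMul K y z).1 ⬝ᵥ x.2 := by
  simp [paraOctonionMul, dotProduct, Fin.sum_univ_four]
  ring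

theorem IsOPlusSpace.exists_isSymmetricComposition [FiniteDimensional K V]
    (hV : IsOPlusSpace 4 Q) : ∃ m, IsSymmetricComposition Q m := by
  obtain ⟨e, he⟩ := hV.exists_coordinates
  have hQ (x : V) : Q x = (e.symm x).1 ⬝ᵥ (e.symm x).2 := by
    rw [← he, Prod.mk.eta, e.apply_symm_apply]
  have hB (x y : V) : Q.polarBilin x y =
      (e.symm x).1 ⬝ᵥ (e.symm y).2 + (e.symm y).1 ⬝ᵥ (e.symm x).2 := by
    have hadd := map_add_polarBilin Q x y
    rw [hQ (x + y), hQ x, hQ y, map_add, Prod.fst_add, Prod.snd_add, add_dotProduct,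
      dotProduct_add, dotProduct_add] at hadd
    linear_combination -hadd
  refine ⟨((paraOctonionMul K).compl₁₂ e.symm.toLinearMap e.symm.toLinearMap).compr₂
    e.toLinearMap, fun x y => ?_, fun x y => ?_, fun x y z => ?_⟩
  · simp [paraOctonionMul_left, hQ]
  · simp [paraOctonionMul_right, hQ]
  · rw [hB, hB]
    simpa using paraOctonionMul_assoc (e.symm x) (e.symm y) (e.symm z)

theorem finrank_map_add_finrank_inf_ker {V₂ : Type w} [AddCommGroup V₂] [Module K V₂]
    [FiniteDimensional K V] (f : V →ₗ[K] V₂) (S : Submodule K V) :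
    finrank K (S.map f) + finrank K (S ⊓ ker f : Submodule K V) = finrank K S := by
  rw [← LinearMap.finrank_range_add_finrank_ker (f.domRestrict S), LinearMap.range_domRestrict,
    LinearMap.ker_domRestrict, ← Submodule.map_comap_subtype, finrank_map_subtype_eq]

namespace IsSymmetricComposition

theorem flip (h : IsSymmetricComposition Q m) : IsSymmetricComposition Q m.flip where
  left x y := h.right x y
  right x y := h.left x y
  assoc x y z := by
    rw [LinearMap.flip_apply, LinearMap.flip_apply, polarBilin_comm, ← h.assoc, polarBilin_comm]

theorem left_add (h : IsSymmetricComposition Q m) (x y z : V) :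
    m (m x y) z + m (m z y) x = Q.polarBilin x z • y := by
  have hadd := h.left (x + z) y
  rw [map_add_polarBilin] at hadd
  simp only [map_add, LinearMap.add_apply, add_smul, h.left] at hadd
  linear_combination (norm := module) hadd

theorem right_add (h : IsSymmetricComposition Q m) (x y z : V) :
    m x (m y z) + m z (m y x) = Q.polarBilin x z • y := by
  rw [add_comm]
  exact h.flip.left_add x y z

theorem map_right_eq_zero (h : IsSymmetricComposition Q m) (hx : x ≠ 0) (hxy : m x y = 0) :
    Q y = 0 := by
  have hright := h.right y x
  rw [hxy, map_zero] at hright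
  exact (smul_eq_zero.1 hright.symm).resolve_right hx

theorem map_left_eq_zero (h : IsSymmetricComposition Q m) (hy : y ≠ 0) (hxy : m x y = 0) :
    Q x = 0 :=
  h.flip.map_right_eq_zero hy hxy

theorem isTotallySingular_ker (h : IsSymmetricComposition Q m) (hx : x ≠ 0) :
    IsTotallySingular Q (ker (m x)) :=
  fun _ hy => h.map_right_eq_zero hx hy

theorem range_le_ker_flip (h : IsSymmetricComposition Q m) (hQx : Q x = 0) :
    range (m x) ≤ ker (m.flip x) := by
  rintro _ ⟨y, rfl⟩
  rw [LinearMap.mem_ker, LinearMap.flip_apply, h.left, hQx, zero_smul]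

variable [FiniteDimensional K V]

theorem isGenerator_ker (h : IsSymmetricComposition Q m) (hV : IsOPlusSpace 4 Q) (hx : x ≠ 0)
    (hQx : Q x = 0) : IsGenerator 4 Q (ker (m x)) := by
  refine ⟨h.isTotallySingular_ker hx, ?_⟩
  have := hV.finrank_le (h.isTotallySingular_ker hx)
  have := hV.finrank_le (h.flip.isTotallySingular_ker hx)
  have := finrank_mono (h.range_le_ker_flip hQx)
  have := LinearMap.finrank_range_add_finrank_ker (m x)
  have := hV.finrank_eq
  omega

theorem range_eq_ker_flip (h : IsSymmetricComposition Q m) (hV : IsOPlusSpace 4 Q) (hx : x ≠ 0)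
    (hQx : Q x = 0) : range (m x) = ker (m.flip x) := by
  refine eq_of_le_of_finrank_le (h.range_le_ker_flip hQx) ?_
  have := LinearMap.finrank_range_add_finrank_ker (m x)
  have := (h.isGenerator_ker hV hx hQx).finrank_eq
  have := (h.flip.isGenerator_ker hV hx hQx).finrank_eq
  have := hV.finrank_eq
  omega

theorem ker_flip_inf_ker_eq_map_perp (h : IsSymmetricComposition Q m) (hV : IsOPlusSpace 4 Q)
    (hx : x ≠ 0) (hQx : Q x = 0) (hxy : m x y = 0) :
    ker (m.flip x) ⊓ ker (m y) = (perp Q (span K {y})).map (m x) := by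
  have hmul (v : V) : m y (m x v) = Q.polarBilin y v • x := by
    rw [← h.right_add y x v, hxy, map_zero, add_zero]
  rw [← h.range_eq_ker_flip hV hx hQx]
  ext z
  simp only [mem_inf, LinearMap.mem_range, LinearMap.mem_ker, mem_map, mem_perp_span_singleton]
  constructor
  · rintro ⟨⟨v, rfl⟩, hz⟩
    rw [hmul] at hz
    exact ⟨v, (smul_eq_zero.1 hz).resolve_right hx, rfl⟩
  · rintro ⟨v, hv, rfl⟩
    exact ⟨⟨v, rfl⟩, by rw [hmul, hv, zero_smul]⟩

theorem finrank_ker_flip_inf_ker_of_mul_eq_zero (h : IsSymmetricComposition Q m)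
    (hV : IsOPlusSpace 4 Q) (hx : x ≠ 0) (hQx : Q x = 0) (hy : y ≠ 0) (hxy : m x y = 0) :
    finrank K (ker (m.flip x) ⊓ ker (m y) : Submodule K V) = 3 := by
  have hker : ker (m x) ≤ perp Q (span K {y}) := by
    intro v hv
    have hadd := h.right_add y x v
    rw [hxy, LinearMap.mem_ker.1 hv, map_zero, map_zero, add_zero] at hadd
    exact mem_perp_span_singleton.2 ((smul_eq_zero.1 hadd.symm).resolve_right hx)
  have hmap := finrank_map_add_finrank_inf_ker (m x) (perp Q (span K {y}))
  rw [inf_eq_right.2 hker, (h.isGenerator_ker hV hx hQx).finrank_eq,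
    ← h.ker_flip_inf_ker_eq_map_perp hV hx hQx hxy] at hmap
  have hperp := hV.finrank_perp (span K {y})
  rw [finrank_span_singleton hy] at hperp
  omega

theorem ker_flip_inf_ker_eq_span (h : IsSymmetricComposition Q m) (hV : IsOPlusSpace 4 Q)
    (hx : x ≠ 0) (hQx : Q x = 0) (hQy : Q y = 0) (hxy : m x y ≠ 0) :
    ker (m.flip x) ⊓ ker (m y) = span K {m x y} := by
  have hQxy : Q (m x y) = 0 := h.map_left_eq_zero hx (by rw [h.left, hQx, zero_smul])
  refine le_antisymm ?_ ((span_singleton_le_iff_mem _ _).2 (mem_inf.2 ⟨?_, ?_⟩))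
  · rw [← h.range_eq_ker_flip hV hx hQx]
    rintro _ ⟨⟨v, rfl⟩, hv⟩
    have hmul : m v (m x y) = Q.polarBilin y v • x := by
      rw [← h.right_add y x v, LinearMap.mem_ker.1 hv, zero_add]
    rw [mem_span_singleton]
    by_cases hB : Q.polarBilin y v = 0
    · have hv' : v ∈ ker (m.flip (m x y)) := by
        rw [LinearMap.mem_ker, LinearMap.flip_apply, hmul, hB, zero_smul]
      rw [← h.range_eq_ker_flip hV hxy hQxy] at hv'
      obtain ⟨u, rfl⟩ := hv'
      refine ⟨Q.polarBilin x u, ?_⟩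
      rw [← h.right_add x (m x y) u, h.left, hQx, zero_smul, map_zero, add_zero]
    · have hleft := h.left v (m x y)
      rw [hmul, map_smul, LinearMap.smul_apply] at hleft
      refine ⟨(Q.polarBilin y v)⁻¹ * Q v, ?_⟩
      rw [mul_smul, ← hleft, smul_smul, inv_mul_cancel₀ hB, one_smul]
  · rw [LinearMap.mem_ker, LinearMap.flip_apply, h.left, hQx, zero_smul]
  · rw [LinearMap.mem_ker, h.right, hQy, zero_smul]

theorem finrank_ker_flip_inf_ker_of_mul_ne_zero (h : IsSymmetricComposition Q m)
    (hV : IsOPlusSpace 4 Q) (hx : x ≠ 0) (hQx : Q x = 0) (hQy : Q y = 0) (hxy : m x y ≠ 0) :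
    finrank K (ker (m.flip x) ⊓ ker (m y) : Submodule K V) = 1 := by
  rw [h.ker_flip_inf_ker_eq_span hV hx hQx hQy hxy, finrank_span_singleton hxy]

theorem finrank_ker_flip_inf_ker_eq_three_iff (h : IsSymmetricComposition Q m)
    (hV : IsOPlusSpace 4 Q) (hx : x ≠ 0) (hQx : Q x = 0) (hy : y ≠ 0) (hQy : Q y = 0) :
    finrank K (ker (m.flip x) ⊓ ker (m y) : Submodule K V) = 3 ↔ m x y = 0 := by
  refine ⟨fun hthree => ?_, h.finrank_ker_flip_inf_ker_of_mul_eq_zero hV hx hQx hy⟩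
  by_contra hxy
  have := h.finrank_ker_flip_inf_ker_of_mul_ne_zero hV hx hQx hQy hxy
  omega

theorem odd_finrank_ker_flip_inf_ker (h : IsSymmetricComposition Q m) (hV : IsOPlusSpace 4 Q)
    (hx : x ≠ 0) (hQx : Q x = 0) (hy : y ≠ 0) (hQy : Q y = 0) :
    Odd (finrank K (ker (m.flip x) ⊓ ker (m y) : Submodule K V)) := by
  by_cases hxy : m x y = 0
  · rw [h.finrank_ker_flip_inf_ker_of_mul_eq_zero hV hx hQx hy hxy]
    decide
  · rw [h.finrank_ker_flip_inf_ker_of_mul_ne_zero hV hx hQx hQy hxy]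
    decide

theorem even_finrank_ker_inf_ker (h : IsSymmetricComposition Q m) (hV : IsOPlusSpace 4 Q)
    (hx : x ≠ 0) (hQx : Q x = 0) (hy : y ≠ 0) (hQy : Q y = 0) :
    Even (finrank K (ker (m x) ⊓ ker (m y) : Submodule K V)) := by
  have hparity := hV.finrank_inf_add_mod_two (h.isGenerator_ker hV hx hQx)
    (h.isGenerator_ker hV hy hQy) (h.flip.isGenerator_ker hV hx hQx)
  have hxx := h.odd_finrank_ker_flip_inf_ker hV hx hQx hx hQx
  have hxy := h.odd_finrank_ker_flip_inf_ker hV hx hQx hy hQy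
  rw [Nat.odd_iff] at hxx hxy
  rw [Nat.even_iff]
  omega

theorem ker_flip_ne_ker (h : IsSymmetricComposition Q m) (hV : IsOPlusSpace 4 Q)
    (hx : x ≠ 0) (hQx : Q x = 0) (hy : y ≠ 0) (hQy : Q y = 0) : ker (m.flip x) ≠ ker (m y) := by
  intro heq
  have hodd := h.odd_finrank_ker_flip_inf_ker hV hx hQx hy hQy
  rw [heq, inf_idem, (h.isGenerator_ker hV hy hQy).finrank_eq] at hodd
  exact absurd hodd (by decide)

theorem ker_flip_le_ker_flip (h : IsSymmetricComposition Q m) (hV : IsOPlusSpace 4 Q)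
    (hx : x ≠ 0) (hQx : Q x = 0) (hy : y ≠ 0) (hQy : Q y = 0) (hxy : ker (m x) = ker (m y)) :
    ker (m.flip x) ≤ ker (m.flip y) := by
  intro w hw
  rcases eq_or_ne w 0 with rfl | hw0
  · exact zero_mem _
  have hQw : Q w = 0 := h.flip.isTotallySingular_ker hx w hw
  rw [LinearMap.mem_ker, LinearMap.flip_apply] at hw ⊢
  rwa [← h.finrank_ker_flip_inf_ker_eq_three_iff hV hw0 hQw hy hQy, ← hxy,
    h.finrank_ker_flip_inf_ker_eq_three_iff hV hw0 hQw hx hQx]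

theorem mem_span_of_ker_eq (h : IsSymmetricComposition Q m) (hV : IsOPlusSpace 4 Q)
    (hx : x ≠ 0) (hQx : Q x = 0) (hy : y ≠ 0) (hQy : Q y = 0) (hxy : ker (m x) = ker (m y)) :
    y ∈ span K {x} := by
  by_contra hyx
  obtain ⟨v, hxv, hyv⟩ : ∃ v, Q.polarBilin x v = 0 ∧ Q.polarBilin y v ≠ 0 := by
    by_contra! hperp
    refine hyx ?_
    rw [← span_singleton_le_iff_mem, ← perp_perp hV.nondegenerate (span K {x}), le_perp_comm]
    exact fun v hv => mem_perp_span_singleton.2 (hperp v (mem_perp_span_singleton.1 hv))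
  have hbot : ker (m x) = ⊥ := by
    rw [eq_bot_iff]
    intro z hzx
    have hzy : m y z = 0 := LinearMap.mem_ker.1 (hxy ▸ hzx)
    have haddx := h.left_add x z v
    have haddy := h.left_add y z v
    rw [LinearMap.mem_ker.1 hzx, map_zero, LinearMap.zero_apply, zero_add, hxv, zero_smul]
      at haddx
    have hvzy : m (m v z) y = 0 := h.ker_flip_le_ker_flip hV hx hQx hy hQy hxy haddx
    rw [hzy, map_zero, LinearMap.zero_apply, zero_add, hvzy] at haddy
    exact (mem_bot K).2 ((smul_eq_zero.1 haddy.symm).resolve_left hyv)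
  have hfinrank := (h.isGenerator_ker hV hx hQx).finrank_eq
  rw [hbot, finrank_bot] at hfinrank
  omega

theorem finrank_ker_inf_ker_le (h : IsSymmetricComposition Q m) (hV : IsOPlusSpace 4 Q)
    (hx : x ≠ 0) (hQx : Q x = 0) (hy : y ≠ 0) (hQy : Q y = 0) (hyx : y ∉ span K {x}) :
    finrank K (ker (m x) ⊓ ker (m y) : Submodule K V) ≤ 2 := by
  have hkerx := h.isGenerator_ker hV hx hQx
  have hkery := h.isGenerator_ker hV hy hQy
  have hlt : finrank K (ker (m x) ⊓ ker (m y) : Submodule K V) < 4 := by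
    rw [← hkerx.finrank_eq]
    refine finrank_lt_finrank_of_lt (inf_lt_left.2 fun hle => hyx ?_)
    exact h.mem_span_of_ker_eq hV hx hQx hy hQy
      (eq_of_le_of_finrank_eq hle (hkerx.finrank_eq.trans hkery.finrank_eq.symm))
  obtain ⟨k, hk⟩ := h.even_finrank_ker_inf_ker hV hx hQx hy hQy
  omega

theorem map_flip_ker_flip_le (h : IsSymmetricComposition Q m) (hV : IsOPlusSpace 4 Q)
    (hx : x ≠ 0) (hQx : Q x = 0) (hQy : Q y = 0) (hB : Q.polarBilin x y = 0) :
    (ker (m.flip x)).map (m.flip y) ≤ ker (m x) ⊓ ker (m y) := by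
  rw [← h.range_eq_ker_flip hV hx hQx]
  rintro _ ⟨_, ⟨v, rfl⟩, rfl⟩
  have hadd := h.left_add x v y
  rw [hB, zero_smul] at hadd
  refine mem_inf.2 ⟨?_, ?_⟩
  · rw [LinearMap.mem_ker, LinearMap.flip_apply, eq_neg_of_add_eq_zero_left hadd, map_neg,
      h.right, hQx, zero_smul, neg_zero]
  · rw [LinearMap.mem_ker, LinearMap.flip_apply, h.right, hQy, zero_smul]

/-- By rank-nullity for `m.flip y` on `ker (m.flip x)`, the two intersections of left and of right
annihilators have dimensions adding up to at least 4, and neither exceeds 2. -/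
theorem finrank_ker_inf_ker (h : IsSymmetricComposition Q m) (hV : IsOPlusSpace 4 Q)
    (hx : x ≠ 0) (hQx : Q x = 0) (hy : y ≠ 0) (hQy : Q y = 0) (hB : Q.polarBilin x y = 0)
    (hyx : y ∉ span K {x}) : finrank K (ker (m x) ⊓ ker (m y) : Submodule K V) = 2 := by
  have := h.finrank_ker_inf_ker_le hV hx hQx hy hQy hyx
  have := h.flip.finrank_ker_inf_ker_le hV hx hQx hy hQy hyx
  have := finrank_mono (h.map_flip_ker_flip_le hV hx hQx hQy hB)
  have := finrank_map_add_finrank_inf_ker (m.flip y) (ker (m.flip x))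
  have := (h.flip.isGenerator_ker hV hx hQx).finrank_eq
  omega

theorem ker_inf_ker_eq_map (h : IsSymmetricComposition Q m) (hV : IsOPlusSpace 4 Q)
    (hx : x ≠ 0) (hQx : Q x = 0) (hy : y ≠ 0) (hQy : Q y = 0) (hB : Q.polarBilin x y = 0)
    (hyx : y ∉ span K {x}) :
    ker (m x) ⊓ ker (m y) = (ker (m.flip x)).map (m.flip y) := by
  refine (eq_of_le_of_finrank_le (h.map_flip_ker_flip_le hV hx hQx hQy hB) ?_).symm
  have := finrank_map_add_finrank_inf_ker (m.flip y) (ker (m.flip x))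
  have := (h.flip.isGenerator_ker hV hx hQx).finrank_eq
  have := h.finrank_ker_inf_ker hV hx hQx hy hQy hB hyx
  have := h.flip.finrank_ker_inf_ker hV hx hQx hy hQy hB hyx
  omega

/-- The point `w` is the perp of the preimage under `m x` of the common hyperplane. -/
theorem exists_eq_ker_of_adjacent (h : IsSymmetricComposition Q m) (hV : IsOPlusSpace 4 Q)
    (hx : x ≠ 0) (hQx : Q x = 0) {Z : Submodule K V} (hZ : IsGenerator 4 Q Z)
    (hadj : finrank K (Z ⊓ ker (m.flip x) : Submodule K V) + 1 = 4) :
    ∃ w, w ≠ 0 ∧ Q w = 0 ∧ Z = ker (m w) := by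
  set H := Z ⊓ ker (m.flip x)
  have hkerx := h.isGenerator_ker hV hx hQx
  have hmap : (H.comap (m x)).map (m x) = H := by
    rw [map_comap_eq, h.range_eq_ker_flip hV hx hQx, inf_eq_right]
    exact inf_le_right
  have hker : ker (m x) ≤ H.comap (m x) := LinearMap.ker_le_comap (m x)
  have hperp : perp Q (H.comap (m x)) ≤ ker (m x) :=
    (perp_anti hker).trans (hV.perp_eq_self hkerx).le
  have hfinrank : finrank K (perp Q (H.comap (m x))) = 1 := by
    have hsum := finrank_map_add_finrank_inf_ker (m x) (H.comap (m x))
    rw [hmap, inf_eq_right.2 hker, hkerx.finrank_eq] at hsum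
    have := hV.finrank_perp (H.comap (m x))
    omega
  obtain ⟨w, hw, hQw, hHw⟩ :=
    isSingularPoint_iff.1 ⟨hkerx.isTotallySingular.mono hperp, hfinrank⟩
  have hxw : m x w = 0 := hperp (hHw ▸ mem_span_singleton_self w)
  have hinf := h.ker_flip_inf_ker_eq_map_perp hV hx hQx hxw
  rw [← hHw, perp_perp hV.nondegenerate, hmap] at hinf
  refine ⟨w, hw, hQw, ?_⟩
  rcases hV.eq_or_eq_of_inf_le hZ (h.flip.isGenerator_ker hV hx hQx)
    (h.isGenerator_ker hV hw hQw) hadj (hinf.ge.trans inf_le_right) with heq | heq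
  · exact heq.symm
  · exact absurd heq.symm (h.ker_flip_ne_ker hV hx hQx hw hQw)

theorem exists_eq_ker (h : IsSymmetricComposition Q m) (hV : IsOPlusSpace 4 Q)
    {U : Submodule K V} (hU : IsGenerator 4 Q U) :
    (∃ x, x ≠ 0 ∧ Q x = 0 ∧ U = ker (m.flip x)) ∨ ∃ x, x ≠ 0 ∧ Q x = 0 ∧ U = ker (m x) := by
  obtain ⟨x, hxU, hx⟩ := exists_mem_ne_zero_of_ne_bot (one_le_finrank_iff.1
    (hU.finrank_eq.ge.trans' (by decide)))
  have hQx := hU.isTotallySingular x hxU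
  refine hV.adjacent_induction
    (P := fun U => (∃ x, x ≠ 0 ∧ Q x = 0 ∧ U = ker (m.flip x)) ∨
      ∃ x, x ≠ 0 ∧ Q x = 0 ∧ U = ker (m x))
    (h.isGenerator_ker hV hx hQx) (Or.inr ⟨x, hx, hQx, rfl⟩) ?_ hU
  rintro Y Z - hZ hZY (⟨y, hy, hQy, rfl⟩ | ⟨y, hy, hQy, rfl⟩)
  · exact Or.inr (h.exists_eq_ker_of_adjacent hV hy hQy hZ hZY)
  · exact Or.inl (h.flip.exists_eq_ker_of_adjacent hV hy hQy hZ hZY)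

end IsSymmetricComposition

end SymmetricComposition

section TrialityExistence

open LinearMap (ker)

variable {K : Type u} [Field K] {V : Type v} [AddCommGroup V] [Module K V]
  {Q : QuadraticForm K V} {m : V →ₗ[K] V →ₗ[K] V} {W U : Submodule K V} {x y : V}

/-- The left annihilator of a subspace `W` for the multiplication `m`; the right annihilator is
`leftAnn m.flip W`. -/
def leftAnn (m : V →ₗ[K] V →ₗ[K] V) (W : Submodule K V) : Submodule K V where
  carrier := {z | ∀ w ∈ W, m z w = 0}
  add_mem' {a b} ha hb w hw := by
    rw [map_add, LinearMap.add_apply, ha w hw, hb w hw, add_zero]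
  zero_mem' w _ := by rw [map_zero, LinearMap.zero_apply]
  smul_mem' c a ha w hw := by rw [map_smul, LinearMap.smul_apply, ha w hw, smul_zero]

theorem mem_leftAnn_iff_le_ker {z : V} : z ∈ leftAnn m W ↔ W ≤ ker (m z) := Iff.rfl

theorem le_leftAnn_comm : W ≤ leftAnn m U ↔ U ≤ leftAnn m.flip W :=
  ⟨fun h _ hu _ hw => h hw _ hu, fun h _ hw _ hu => h hu _ hw⟩

theorem leftAnn_anti (h : W ≤ U) : leftAnn m U ≤ leftAnn m W :=
  fun _ hz _ hw => hz _ (h hw)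

theorem leftAnn_span_singleton (x : V) : leftAnn m (span K {x}) = ker (m.flip x) := by
  ext z
  rw [mem_leftAnn_iff_le_ker, span_singleton_le_iff_mem, LinearMap.mem_ker, LinearMap.mem_ker,
    LinearMap.flip_apply]

theorem leftAnn_sup (W U : Submodule K V) : leftAnn m (W ⊔ U) = leftAnn m W ⊓ leftAnn m U := by
  ext z
  rw [mem_inf, mem_leftAnn_iff_le_ker, mem_leftAnn_iff_le_ker, mem_leftAnn_iff_le_ker, sup_le_iff]

open Classical in
/-- The action on subspaces of the triality map attached to a symmetric composition `m`. Points
and lines go to their left annihilators, and so does the right annihilator of a point, which gives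
back the point. The left annihilator of `ker (m.flip x)` is zero, which identifies that solid as
the image of `⟨x⟩`; it goes to `ker (m x)`. -/
noncomputable def trialityFun (m : V →ₗ[K] V →ₗ[K] V) (W : Submodule K V) : Submodule K V :=
  if leftAnn m W = ⊥ then leftAnn m.flip (leftAnn m.flip W) else leftAnn m W

theorem trialityFun_of_ne_bot (hW : leftAnn m W ≠ ⊥) : trialityFun m W = leftAnn m W :=
  if_neg hW

theorem IsSymmetricComposition.isTotallySingular_leftAnn (h : IsSymmetricComposition Q m)
    (hW : W ≠ ⊥) : IsTotallySingular Q (leftAnn m W) := by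
  obtain ⟨x, hx, hx0⟩ := exists_mem_ne_zero_of_ne_bot hW
  exact fun z hz => h.map_left_eq_zero hx0 (hz x hx)

theorem Element.incident_comm {E E' : Element Q} : E.Incident E' ↔ E'.Incident E := by
  unfold Element.Incident
  rw [inf_comm]
  tauto

variable [FiniteDimensional K V]

theorem ne_bot_of_finrank_pos (hW : 0 < finrank K W) : W ≠ ⊥ :=
  one_le_finrank_iff.1 hW

theorem exists_eq_span_sup_span (hW : finrank K W = 2) :
    ∃ x y, x ≠ 0 ∧ y ≠ 0 ∧ x ∈ W ∧ y ∈ W ∧ y ∉ span K {x} ∧ W = span K {x} ⊔ span K {y} := by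
  obtain ⟨x, hx, hx0⟩ := exists_mem_ne_zero_of_ne_bot (ne_bot_of_finrank_pos (hW ▸ two_pos))
  have hle : span K {x} ≤ W := (span_singleton_le_iff_mem _ _).2 hx
  have hfinrank := finrank_span_singleton (K := K) hx0
  obtain ⟨y, hy, hyx⟩ : ∃ y ∈ W, y ∉ span K {x} := by
    by_contra! hc
    have := finrank_mono (show W ≤ span K {x} from hc)
    omega
  exact ⟨x, y, hx0, fun hy0 => hyx (hy0 ▸ zero_mem _), hx, hy, hyx,
    (sup_span_singleton_eq_of_finrank_add_one hle (by omega) hy hyx).symm⟩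

namespace IsSymmetricComposition

theorem leftAnn_ker (h : IsSymmetricComposition Q m) (hV : IsOPlusSpace 4 Q) (hx : x ≠ 0)
    (hQx : Q x = 0) : leftAnn m (ker (m x)) = span K {x} := by
  refine le_antisymm (fun z hz => ?_) ((span_singleton_le_iff_mem _ _).2 fun _ hw => hw)
  rcases eq_or_ne z 0 with rfl | hz0
  · exact zero_mem _
  have hkerx := h.isGenerator_ker hV hx hQx
  have hne := ne_bot_of_finrank_pos (hkerx.finrank_eq ▸ four_pos)
  have hQz : Q z = 0 := h.isTotallySingular_leftAnn hne z hz
  exact h.mem_span_of_ker_eq hV hx hQx hz0 hQz (eq_of_le_of_finrank_eq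
    (mem_leftAnn_iff_le_ker.1 hz)
    (hkerx.finrank_eq.trans (h.isGenerator_ker hV hz0 hQz).finrank_eq.symm))

theorem leftAnn_ker_flip (h : IsSymmetricComposition Q m) (hV : IsOPlusSpace 4 Q) (hx : x ≠ 0)
    (hQx : Q x = 0) : leftAnn m (ker (m.flip x)) = ⊥ := by
  rw [eq_bot_iff]
  intro z hz
  rw [mem_bot]
  by_contra hz0
  have hkerx := h.flip.isGenerator_ker hV hx hQx
  have hne := ne_bot_of_finrank_pos (hkerx.finrank_eq ▸ four_pos)
  have hQz : Q z = 0 := h.isTotallySingular_leftAnn hne z hz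
  exact h.ker_flip_ne_ker hV hx hQx hz0 hQz (eq_of_le_of_finrank_eq
    (mem_leftAnn_iff_le_ker.1 hz)
    (hkerx.finrank_eq.trans (h.isGenerator_ker hV hz0 hQz).finrank_eq.symm))

theorem finrank_leftAnn (h : IsSymmetricComposition Q m) (hV : IsOPlusSpace 4 Q)
    (hW : IsTotallySingular Q W) (hW2 : finrank K W = 2) : finrank K (leftAnn m W) = 2 := by
  obtain ⟨x, y, hx, hy, hxW, hyW, hyx, rfl⟩ := exists_eq_span_sup_span hW2
  rw [leftAnn_sup, leftAnn_span_singleton, leftAnn_span_singleton]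
  exact h.flip.finrank_ker_inf_ker hV hx (hW x hxW) hy (hW y hyW)
    (hW.polarBilin_eq_zero hxW hyW) hyx

theorem leftAnn_flip_leftAnn (h : IsSymmetricComposition Q m) (hV : IsOPlusSpace 4 Q)
    (hW : IsTotallySingular Q W) (hW2 : finrank K W = 2) :
    leftAnn m.flip (leftAnn m W) = W := by
  have hne : W ≠ ⊥ := ne_bot_of_finrank_pos (hW2 ▸ two_pos)
  have hfinrank := h.flip.finrank_leftAnn hV (h.isTotallySingular_leftAnn hne)
    (h.finrank_leftAnn hV hW hW2)
  exact (eq_of_le_of_finrank_eq (le_leftAnn_comm.1 le_rfl) (hW2.trans hfinrank.symm)).symm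

theorem leftAnn_flip_le_leftAnn_leftAnn (h : IsSymmetricComposition Q m)
    (hV : IsOPlusSpace 4 Q) (hW : IsTotallySingular Q W) (hW2 : finrank K W = 2) :
    leftAnn m.flip W ≤ leftAnn m (leftAnn m W) := by
  obtain ⟨x, y, hx, hy, hxW, hyW, hyx, rfl⟩ := exists_eq_span_sup_span hW2
  have hB := hW.polarBilin_eq_zero hxW hyW
  rw [leftAnn_sup, leftAnn_sup, leftAnn_span_singleton, leftAnn_span_singleton,
    leftAnn_span_singleton, leftAnn_span_singleton, LinearMap.flip_flip,
    h.ker_inf_ker_eq_map hV hx (hW x hxW) hy (hW y hyW) hB hyx]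
  rintro _ ⟨s, hs, rfl⟩ z hz
  obtain ⟨hzx, hzy⟩ := mem_inf.1 hz
  have hadd := h.left_add s y z
  rw [LinearMap.mem_ker, LinearMap.flip_apply] at hzy
  rwa [hzy, map_zero, LinearMap.zero_apply, add_zero,
    (h.flip.isTotallySingular_ker hx).polarBilin_eq_zero hs hzx, zero_smul] at hadd

theorem trialityFun_span_singleton (h : IsSymmetricComposition Q m) (hV : IsOPlusSpace 4 Q)
    (hx : x ≠ 0) (hQx : Q x = 0) : trialityFun m (span K {x}) = ker (m.flip x) := by
  rw [← leftAnn_span_singleton]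
  refine trialityFun_of_ne_bot (ne_bot_of_finrank_pos ?_)
  rw [leftAnn_span_singleton, (h.flip.isGenerator_ker hV hx hQx).finrank_eq]
  exact four_pos

theorem trialityFun_ker_flip (h : IsSymmetricComposition Q m) (hV : IsOPlusSpace 4 Q)
    (hx : x ≠ 0) (hQx : Q x = 0) : trialityFun m (ker (m.flip x)) = ker (m x) := by
  rw [trialityFun, if_pos (h.leftAnn_ker_flip hV hx hQx), h.flip.leftAnn_ker hV hx hQx,
    leftAnn_span_singleton, LinearMap.flip_flip]

theorem trialityFun_ker (h : IsSymmetricComposition Q m) (hV : IsOPlusSpace 4 Q)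
    (hx : x ≠ 0) (hQx : Q x = 0) : trialityFun m (ker (m x)) = span K {x} := by
  rw [← h.leftAnn_ker hV hx hQx]
  refine trialityFun_of_ne_bot ?_
  rwa [h.leftAnn_ker hV hx hQx, Ne, span_singleton_eq_bot]

theorem trialityFun_line (h : IsSymmetricComposition Q m) (hV : IsOPlusSpace 4 Q)
    (hW : IsTotallySingular Q W) (hW2 : finrank K W = 2) : trialityFun m W = leftAnn m W :=
  trialityFun_of_ne_bot (ne_bot_of_finrank_pos (h.finrank_leftAnn hV hW hW2 ▸ two_pos))

theorem element_cases (h : IsSymmetricComposition Q m) (hV : IsOPlusSpace 4 Q) (E : Element Q) :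
    (∃ x, x ≠ 0 ∧ Q x = 0 ∧ E.1 = span K {x}) ∨ E.dim = 2 ∨
      (∃ x, x ≠ 0 ∧ Q x = 0 ∧ E.1 = ker (m.flip x)) ∨
        ∃ x, x ≠ 0 ∧ Q x = 0 ∧ E.1 = ker (m x) := by
  obtain ⟨W, hW, hdim | hdim | hdim⟩ := E
  · exact Or.inl (isSingularPoint_iff.1 ⟨hW, hdim⟩)
  · exact Or.inr (Or.inl hdim)
  · exact Or.inr (Or.inr (h.exists_eq_ker hV ⟨hW, hdim⟩))

theorem isTotallySingular_trialityFun (h : IsSymmetricComposition Q m) (hV : IsOPlusSpace 4 Q)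
    (E : Element Q) : IsTotallySingular Q (trialityFun m E.1) := by
  rcases h.element_cases hV E with ⟨x, hx, hQx, hE⟩ | hE | ⟨x, hx, hQx, hE⟩ | ⟨x, hx, hQx, hE⟩
  · rw [hE, h.trialityFun_span_singleton hV hx hQx]
    exact h.flip.isTotallySingular_ker hx
  · rw [h.trialityFun_line hV E.2.1 hE]
    exact h.isTotallySingular_leftAnn (ne_bot_of_finrank_pos (two_pos.trans_eq hE.symm))
  · rw [hE, h.trialityFun_ker_flip hV hx hQx]
    exact h.isTotallySingular_ker hx
  · rw [hE, h.trialityFun_ker hV hx hQx]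
    exact isTotallySingular_span_singleton hQx

theorem finrank_trialityFun (h : IsSymmetricComposition Q m) (hV : IsOPlusSpace 4 Q)
    (E : Element Q) : finrank K (trialityFun m E.1) = 1 ∨ finrank K (trialityFun m E.1) = 2 ∨
      finrank K (trialityFun m E.1) = 4 := by
  rcases h.element_cases hV E with ⟨x, hx, hQx, hE⟩ | hE | ⟨x, hx, hQx, hE⟩ | ⟨x, hx, hQx, hE⟩
  · rw [hE, h.trialityFun_span_singleton hV hx hQx]
    exact Or.inr (Or.inr (h.flip.isGenerator_ker hV hx hQx).finrank_eq)
  · rw [h.trialityFun_line hV E.2.1 hE]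
    exact Or.inr (Or.inl (h.finrank_leftAnn hV E.2.1 hE))
  · rw [hE, h.trialityFun_ker_flip hV hx hQx]
    exact Or.inr (Or.inr (h.isGenerator_ker hV hx hQx).finrank_eq)
  · rw [hE, h.trialityFun_ker hV hx hQx]
    exact Or.inl (finrank_span_singleton hx)

theorem trialityFun_flip_trialityFun (h : IsSymmetricComposition Q m) (hV : IsOPlusSpace 4 Q)
    (E : Element Q) : trialityFun m.flip (trialityFun m E.1) = E.1 := by
  rcases h.element_cases hV E with ⟨x, hx, hQx, hE⟩ | hE | ⟨x, hx, hQx, hE⟩ | ⟨x, hx, hQx, hE⟩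
  · rw [hE, h.trialityFun_span_singleton hV hx hQx, h.flip.trialityFun_ker hV hx hQx]
  · have hne := ne_bot_of_finrank_pos (two_pos.trans_eq hE.symm)
    rw [h.trialityFun_line hV E.2.1 hE, h.flip.trialityFun_line hV
      (h.isTotallySingular_leftAnn hne) (h.finrank_leftAnn hV E.2.1 hE),
      h.leftAnn_flip_leftAnn hV E.2.1 hE]
  · rw [hE, h.trialityFun_ker_flip hV hx hQx]
    exact h.flip.trialityFun_ker_flip hV hx hQx
  · rw [hE, h.trialityFun_ker hV hx hQx, h.flip.trialityFun_span_singleton hV hx hQx,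
      LinearMap.flip_flip]

/-- The permutation of the elements of the triality geometry attached to a symmetric
composition. -/
noncomputable def trialityPerm (h : IsSymmetricComposition Q m) (hV : IsOPlusSpace 4 Q) :
    Equiv.Perm (Element Q) where
  toFun E := ⟨trialityFun m E.1, h.isTotallySingular_trialityFun hV E,
    h.finrank_trialityFun hV E⟩
  invFun E := ⟨trialityFun m.flip E.1, h.flip.isTotallySingular_trialityFun hV E,
    h.flip.finrank_trialityFun hV E⟩
  left_inv E := Subtype.ext (h.trialityFun_flip_trialityFun hV E)
  right_inv E := Subtype.ext (h.flip.trialityFun_flip_trialityFun hV E)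

theorem coe_trialityPerm (h : IsSymmetricComposition Q m) (hV : IsOPlusSpace 4 Q)
    (E : Element Q) : (h.trialityPerm hV E).1 = trialityFun m E.1 := rfl

theorem exists_eq_ker_flip_of_leftAnn_eq_bot (h : IsSymmetricComposition Q m)
    (hV : IsOPlusSpace 4 Q) {E : Element Q} (hbot : leftAnn m E.1 = ⊥) :
    ∃ x, x ≠ 0 ∧ Q x = 0 ∧ E.1 = ker (m.flip x) := by
  rcases h.element_cases hV E with ⟨x, hx, hQx, hE⟩ | hE | hE | ⟨x, hx, hQx, hE⟩
  · rw [hE, leftAnn_span_singleton] at hbot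
    have hpos := (h.flip.isGenerator_ker hV hx hQx).finrank_eq ▸ four_pos
    exact absurd hbot (ne_bot_of_finrank_pos hpos)
  · have hpos := h.finrank_leftAnn hV E.2.1 hE ▸ two_pos
    exact absurd hbot (ne_bot_of_finrank_pos hpos)
  · exact hE
  · rw [hE, h.leftAnn_ker hV hx hQx, span_singleton_eq_bot] at hbot
    exact absurd hbot hx

theorem incident_trialityPerm_of_le_ker_flip (h : IsSymmetricComposition Q m)
    (hV : IsOPlusSpace 4 Q) {E E' : Element Q} (hle : E.1 ≤ E'.1) (hy : y ≠ 0) (hQy : Q y = 0)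
    (hE' : E'.1 = ker (m.flip y)) : (h.trialityPerm hV E).Incident (h.trialityPerm hV E') := by
  have hkery := h.isGenerator_ker hV hy hQy
  have himage : (h.trialityPerm hV E').1 = ker (m y) := by
    rw [coe_trialityPerm, hE', h.trialityFun_ker_flip hV hy hQy]
  rcases E.2.2 with hdim | hdim | hdim
  · obtain ⟨x, hx, hQx, hE⟩ := isSingularPoint_iff.1 ⟨E.2.1, hdim⟩
    have hxE : x ∈ E.1 := hE ▸ mem_span_singleton_self x
    have hxy : m x y = 0 := hE'.le (hle hxE)
    refine Or.inr (Or.inr ⟨?_, ?_, ?_⟩)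
    · rw [Element.dim, coe_trialityPerm, hE, h.trialityFun_span_singleton hV hx hQx,
        (h.flip.isGenerator_ker hV hx hQx).finrank_eq]
    · rw [Element.dim, himage, hkery.finrank_eq]
    · rw [himage, coe_trialityPerm, hE, h.trialityFun_span_singleton hV hx hQx]
      exact h.finrank_ker_flip_inf_ker_of_mul_eq_zero hV hx hQx hy hxy
  · refine Or.inl ?_
    rw [himage, coe_trialityPerm, h.trialityFun_line hV E.2.1 hdim, ← mem_leftAnn_iff_le_ker]
    exact h.leftAnn_flip_le_leftAnn_leftAnn hV E.2.1 hdim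
      (mem_leftAnn_iff_le_ker.2 (hle.trans hE'.le))
  · have heq : E = E' := Subtype.ext (eq_of_le_of_finrank_eq hle
      (hdim.trans (hE' ▸ (h.flip.isGenerator_ker hV hy hQy).finrank_eq.symm)))
    exact Or.inl (heq ▸ le_rfl)

theorem incident_trialityPerm_of_le (h : IsSymmetricComposition Q m) (hV : IsOPlusSpace 4 Q)
    {E E' : Element Q} (hle : E.1 ≤ E'.1) :
    (h.trialityPerm hV E).Incident (h.trialityPerm hV E') := by
  by_cases hbot : leftAnn m E'.1 = ⊥
  · obtain ⟨y, hy, hQy, hE'⟩ := h.exists_eq_ker_flip_of_leftAnn_eq_bot hV hbot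
    exact h.incident_trialityPerm_of_le_ker_flip hV hle hy hQy hE'
  · refine Or.inr (Or.inl ?_)
    rw [coe_trialityPerm, coe_trialityPerm, trialityFun_of_ne_bot hbot,
      trialityFun_of_ne_bot (ne_bot_of_le_ne_bot hbot (leftAnn_anti hle))]
    exact leftAnn_anti hle

theorem incident_trialityPerm_of_finrank_inf (h : IsSymmetricComposition Q m)
    (hV : IsOPlusSpace 4 Q) {E E' : Element Q} (hE : E.dim = 4) (hE' : E'.dim = 4)
    (hinf : finrank K (E.1 ⊓ E'.1 : Submodule K V) = 3) :
    (h.trialityPerm hV E).Incident (h.trialityPerm hV E') := by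
  have hker {E E' : Element Q} {x y : V} (hx : x ≠ 0) (hQx : Q x = 0)
      (hE : E.1 = ker (m.flip x)) (hy : y ≠ 0) (hQy : Q y = 0) (hE' : E'.1 = ker (m y))
      (hinf : finrank K (E.1 ⊓ E'.1 : Submodule K V) = 3) :
      (h.trialityPerm hV E).Incident (h.trialityPerm hV E') := by
    refine Or.inr (Or.inl ?_)
    rw [coe_trialityPerm, coe_trialityPerm, hE, hE', h.trialityFun_ker hV hy hQy,
      h.trialityFun_ker_flip hV hx hQx, span_singleton_le_iff_mem, LinearMap.mem_ker,
      ← h.finrank_ker_flip_inf_ker_eq_three_iff hV hx hQx hy hQy, ← hE, ← hE', hinf]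
  rcases h.exists_eq_ker hV ⟨E.2.1, hE⟩ with ⟨x, hx, hQx, hx'⟩ | ⟨x, hx, hQx, hx'⟩ <;>
    rcases h.exists_eq_ker hV ⟨E'.2.1, hE'⟩ with ⟨y, hy, hQy, hy'⟩ | ⟨y, hy, hQy, hy'⟩
  · have heven := h.flip.even_finrank_ker_inf_ker hV hx hQx hy hQy
    rw [← hx', ← hy', hinf] at heven
    exact absurd heven (by decide)
  · exact hker hx hQx hx' hy hQy hy' hinf
  · exact Element.incident_comm.1 (hker hy hQy hy' hx hQx hx' (inf_comm E.1 E'.1 ▸ hinf))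
  · have heven := h.even_finrank_ker_inf_ker hV hx hQx hy hQy
    rw [← hx', ← hy', hinf] at heven
    exact absurd heven (by decide)

theorem incident_trialityPerm (h : IsSymmetricComposition Q m) (hV : IsOPlusSpace 4 Q)
    {E E' : Element Q} (hinc : E.Incident E') :
    (h.trialityPerm hV E).Incident (h.trialityPerm hV E') := by
  rcases hinc with hle | hle | ⟨hE, hE', hinf⟩
  · exact h.incident_trialityPerm_of_le hV hle
  · exact Element.incident_comm.1 (h.incident_trialityPerm_of_le hV hle)
  · exact h.incident_trialityPerm_of_finrank_inf hV hE hE' hinf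

theorem incident_trialityPerm_iff (h : IsSymmetricComposition Q m) (hV : IsOPlusSpace 4 Q)
    (E E' : Element Q) :
    (h.trialityPerm hV E).Incident (h.trialityPerm hV E') ↔ E.Incident E' := by
  refine ⟨fun hinc => ?_, h.incident_trialityPerm hV⟩
  have hsymm := h.flip.incident_trialityPerm hV hinc
  change ((h.trialityPerm hV).symm _).Incident ((h.trialityPerm hV).symm _) at hsymm
  rwa [Equiv.symm_apply_apply, Equiv.symm_apply_apply] at hsymm

theorem sameType_ker_ker (h : IsSymmetricComposition Q m) (hV : IsOPlusSpace 4 Q)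
    (hx : x ≠ 0) (hQx : Q x = 0) (hy : y ≠ 0) (hQy : Q y = 0) :
    SameType 4 (ker (m x)) (ker (m y)) :=
  Nat.even_iff.1 (h.even_finrank_ker_inf_ker hV hx hQx hy hQy)

theorem not_sameType_ker_flip_ker (h : IsSymmetricComposition Q m) (hV : IsOPlusSpace 4 Q)
    (hx : x ≠ 0) (hQx : Q x = 0) (hy : y ≠ 0) (hQy : Q y = 0) :
    ¬ SameType 4 (ker (m.flip x)) (ker (m y)) := fun hsame =>
  Nat.not_even_iff_odd.2 (h.odd_finrank_ker_flip_inf_ker hV hx hQx hy hQy)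
    (Nat.even_iff.2 hsame)

theorem type_rotation_trialityFun (h : IsSymmetricComposition Q m) (hV : IsOPlusSpace 4 Q)
    (hx : x ≠ 0) (hQx : Q x = 0) (E : Element Q) :
    (finrank K E.1 = 1 ↔ finrank K (trialityFun m E.1) = 4 ∧
      SameType 4 (ker (m.flip x)) (trialityFun m E.1)) ∧
    ((finrank K E.1 = 4 ∧ SameType 4 (ker (m.flip x)) E.1) ↔
      finrank K (trialityFun m E.1) = 4 ∧
        ¬ SameType 4 (ker (m.flip x)) (trialityFun m E.1)) ∧
    ((finrank K E.1 = 4 ∧ ¬ SameType 4 (ker (m.flip x)) E.1) ↔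
      finrank K (trialityFun m E.1) = 1) := by
  rcases h.element_cases hV E with ⟨y, hy, hQy, hE⟩ | hE | ⟨y, hy, hQy, hE⟩ | ⟨y, hy, hQy, hE⟩
  · rw [hE, h.trialityFun_span_singleton hV hy hQy]
    simp [finrank_span_singleton hy, (h.flip.isGenerator_ker hV hy hQy).finrank_eq,
      h.flip.sameType_ker_ker hV hx hQx hy hQy]
  · rw [h.trialityFun_line hV E.2.1 hE]
    simp [h.finrank_leftAnn hV E.2.1 hE, show finrank K E.1 = 2 from hE]
  · rw [hE, h.trialityFun_ker_flip hV hy hQy]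
    simp [(h.isGenerator_ker hV hy hQy).finrank_eq,
      (h.flip.isGenerator_ker hV hy hQy).finrank_eq, h.flip.sameType_ker_ker hV hx hQx hy hQy,
      h.not_sameType_ker_flip_ker hV hx hQx hy hQy]
  · rw [hE, h.trialityFun_ker hV hy hQy]
    simp [finrank_span_singleton hy, (h.isGenerator_ker hV hy hQy).finrank_eq,
      h.not_sameType_ker_flip_ker hV hx hQx hy hQy]

theorem nonempty_triality (h : IsSymmetricComposition Q m) (hV : IsOPlusSpace 4 Q) :
    Nonempty (Triality Q) := by
  obtain ⟨W, hW, hW4⟩ := hV.exists_totallySingular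
  obtain ⟨x, hxW, hx⟩ := exists_mem_ne_zero_of_ne_bot (ne_bot_of_finrank_pos (hW4 ▸ four_pos))
  have hM := h.flip.isGenerator_ker hV hx (hW x hxW)
  exact ⟨{
    toPerm := h.trialityPerm hV
    incident_iff := h.incident_trialityPerm_iff hV
    type_rotation := ⟨⟨_, hM.isTotallySingular, Or.inr (Or.inr hM.finrank_eq)⟩, hM.finrank_eq,
      h.type_rotation_trialityFun hV hx (hW x hxW)⟩ }⟩

end IsSymmetricComposition

theorem IsOPlusSpace.nonempty_triality (hV : IsOPlusSpace 4 Q) : Nonempty (Triality Q) := by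
  obtain ⟨m, hm⟩ := hV.exists_isSymmetricComposition
  exact hm.nonempty_triality hV

end TrialityExistence

section Counting

variable {K : Type u} [Field K] {V : Type v} [AddCommGroup V] [Module K V]
  {Q : QuadraticForm K V} {n : ℕ}

theorem natCard_dotProduct_eq_zero {x : Fin (n + 1) → K} (hx : x ≠ 0) :
    Nat.card {y : Fin (n + 1) → K // x ⬝ᵥ y = 0} = Nat.card K ^ n := by
  have hne : dotProductBilin K K x ≠ 0 := fun h =>
    hx (dotProduct_eq_zero _ fun y => LinearMap.congr_fun h y)
  have hker : finrank K (LinearMap.ker (dotProductBilin K K x)) = n := by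
    have hfinrank := Dual.finrank_ker_add_one_of_ne_zero (f := dotProductBilin K K x) hne
    rwa [finrank_fin_fun, Nat.add_right_cancel_iff] at hfinrank
  exact (natCard_eq_pow_finrank (K := K) (V := LinearMap.ker (dotProductBilin K K x))).trans
    (by rw [hker])

theorem natCard_pairs_dotProduct_eq_zero (K : Type u) [Field K] [Finite K] (n : ℕ) :
    Nat.card {p : (Fin (n + 1) → K) × (Fin (n + 1) → K) // p.1 ⬝ᵥ p.2 = 0} =
      Nat.card K ^ (n + 1) + (Nat.card K ^ (n + 1) - 1) * Nat.card K ^ n := by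
  classical
  have := Fintype.ofFinite K
  have hfiber (x : Fin (n + 1) → K) : Nat.card {y : Fin (n + 1) → K // x ⬝ᵥ y = 0} =
      if x = 0 then Nat.card K ^ (n + 1) else Nat.card K ^ n := by
    split_ifs with hx
    · simp [hx]
    · exact natCard_dotProduct_eq_zero hx
  rw [Nat.card_congr (Equiv.subtypeProdEquivSigmaSubtype fun x y : Fin (n + 1) → K => x ⬝ᵥ y = 0),
    Nat.card_sigma, Fintype.sum_eq_add_sum_compl 0, hfiber, if_pos rfl,
    Finset.sum_congr rfl fun x hx => (hfiber x).trans (if_neg (by simpa using hx)),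
    Finset.sum_const, Finset.card_compl, Finset.card_singleton, smul_eq_mul,
    Fintype.card_pi_const, ← Nat.card_eq_fintype_card]

variable [Finite K] [FiniteDimensional K V]

theorem IsOPlusSpace.ncard_singular (hV : IsOPlusSpace (n + 1) Q) :
    {v : V | v ≠ 0 ∧ Q v = 0}.ncard = (Nat.card K ^ n + 1) * (Nat.card K ^ (n + 1) - 1) := by
  have := finite_of_finite K (M := V)
  obtain ⟨e, he⟩ := hV.exists_coordinates
  have hzeros : {v : V | Q v = 0}.ncard =
      Nat.card K ^ (n + 1) + (Nat.card K ^ (n + 1) - 1) * Nat.card K ^ n := by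
    rw [← natCard_pairs_dotProduct_eq_zero K n]
    exact (Nat.card_congr (e.toEquiv.subtypeEquiv fun p => by
      rw [← he p.1 p.2]; rfl)).symm
  have hset : {v : V | v ≠ 0 ∧ Q v = 0} = {v : V | Q v = 0} \ {0} := by
    ext v
    simp [and_comm]
  rw [hset, Set.ncard_sdiff_singleton_of_mem (by simp), hzeros,
    Nat.sub_add_comm (Nat.one_le_pow _ _ Nat.card_pos)]
  ring

theorem ncard_ne_zero_mem (W : Submodule K V) :
    {v : V | v ≠ 0 ∧ v ∈ W}.ncard = Nat.card K ^ finrank K W - 1 := by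
  have := finite_of_finite K (M := V)
  have hset : {v : V | v ≠ 0 ∧ v ∈ W} = (W : Set V) \ {0} := by
    ext v
    simp [and_comm]
  rw [hset, Set.ncard_sdiff_singleton_of_mem (by simp), ← natCard_eq_pow_finrank]
  rfl

theorem ncard_ne_zero_mem_of_pairwise_inf_eq_bot {S : Set (Submodule K V)} {A : Submodule K V}
    {d : ℕ} (hd : ∀ W ∈ S, finrank K (W ⊓ A : Submodule K V) = d)
    (hS : ∀ W ∈ S, ∀ U ∈ S, W ≠ U → W ⊓ U = ⊥) :
    {v : V | v ≠ 0 ∧ v ∈ A ∧ ∃ W ∈ S, v ∈ W}.ncard = S.ncard * (Nat.card K ^ d - 1) := by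
  have := finite_of_finite K (M := V)
  have hunion : {v : V | v ≠ 0 ∧ v ∈ A ∧ ∃ W ∈ S, v ∈ W} =
      ⋃ W ∈ S, {v : V | v ≠ 0 ∧ v ∈ W ⊓ A} := by
    ext v
    simp only [Set.mem_ofPred_eq, Set.mem_iUnion, mem_inf]
    exact ⟨fun ⟨hv, hA, W, hW, hvW⟩ => ⟨W, hW, hv, hvW, hA⟩,
      fun ⟨W, hW, hv, hvW, hA⟩ => ⟨hv, hA, W, hW, hvW⟩⟩
  have hdisjoint : S.PairwiseDisjoint fun W => {v : V | v ≠ 0 ∧ v ∈ W ⊓ A} := by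
    refine fun W hW U hU hne => Set.disjoint_left.2 fun v hv hv' => hv.1 ?_
    rw [← mem_bot K, ← hS W hW U hU hne]
    exact ⟨hv.2.1, hv'.2.1⟩
  rw [hunion, S.toFinite.ncard_biUnion (fun _ _ => Set.toFinite _) hdisjoint,
    finsum_mem_congr rfl fun W hW => (ncard_ne_zero_mem (W ⊓ A)).trans (by rw [hd W hW]),
    finsum_mem_eq_finite_toFinset_sum _ S.toFinite, Finset.sum_const, smul_eq_mul,
    Set.ncard_eq_toFinset_card S S.toFinite]

end Counting

section Triality

variable {K : Type u} [Field K] {V : Type v} [AddCommGroup V] [Module K V]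
  {Q : QuadraticForm K V} {τ : Triality Q} {M : Element Q} {W U X p p' : Submodule K V}
  {Ω : Set (Submodule K V)} {n : ℕ}

/-- A singular point as an element of the triality geometry. -/
def IsSingularPoint.element (hp : IsSingularPoint Q p) : Element Q :=
  ⟨p, hp.1, Or.inl hp.2⟩

theorem IsSingularPoint.dim_element (hp : IsSingularPoint Q p) : hp.element.dim = 1 :=
  hp.2

/-- A totally singular solid as an element of the triality geometry. -/
def IsGenerator.element (hW : IsGenerator 4 Q W) : Element Q :=
  ⟨W, hW.isTotallySingular, Or.inr (Or.inr hW.finrank_eq)⟩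

theorem IsGenerator.sameType_self (hW : IsGenerator n Q W) : SameType n W W := by
  rw [SameType, inf_idem, hW.finrank_eq]

/-- The triality map `τ` takes the singular points to the solids of the type of `M`, these to the
solids of the other type, and those back to the singular points. -/
structure Triality.RotatesFrom (τ : Triality Q) (M : Element Q) : Prop where
  dim_eq_four : M.dim = 4
  dim_eq_one_iff (x : Element Q) :
    x.dim = 1 ↔ (τ.toPerm x).dim = 4 ∧ SameType 4 M.1 (τ.toPerm x).1
  sameType_iff (x : Element Q) :
    (x.dim = 4 ∧ SameType 4 M.1 x.1) ↔ (τ.toPerm x).dim = 4 ∧ ¬ SameType 4 M.1 (τ.toPerm x).1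
  not_sameType_iff (x : Element Q) :
    (x.dim = 4 ∧ ¬ SameType 4 M.1 x.1) ↔ (τ.toPerm x).dim = 1

theorem Triality.exists_rotatesFrom (τ : Triality Q) : ∃ M, τ.RotatesFrom M := by
  obtain ⟨M, hM, hτ⟩ := τ.type_rotation
  exact ⟨M, hM, fun x => (hτ x).1, fun x => (hτ x).2.1, fun x => (hτ x).2.2⟩

theorem Triality.ncard_image (hΩ : ∀ p ∈ Ω, IsSingularPoint Q p) :
    (τ.image Ω).ncard = Ω.ncard := by
  refine (Set.ncard_congr (fun p hp => (τ.toPerm (hΩ p hp).element).1)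
    (fun p hp => ?_) (fun p p' hp hp' heq => ?_) ?_).symm
  · exact ⟨(hΩ p hp).element, hp, rfl⟩
  · exact congrArg Subtype.val (τ.toPerm.injective (Subtype.ext heq))
  · rintro _ ⟨x, hx, rfl⟩
    exact ⟨x.1, hx, rfl⟩

theorem Triality.RotatesFrom.dim_eq_two_iff (h : τ.RotatesFrom M) (x : Element Q) :
    (τ.toPerm x).dim = 2 ↔ x.dim = 2 := by
  have hpoint := h.dim_eq_one_iff x
  have hsame := h.sameType_iff x
  have hother := h.not_sameType_iff x
  have hx : x.dim = 1 ∨ x.dim = 2 ∨ x.dim = 4 := x.2.2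
  have hτx : (τ.toPerm x).dim = 1 ∨ (τ.toPerm x).dim = 2 ∨ (τ.toPerm x).dim = 4 :=
    (τ.toPerm x).2.2
  grind

theorem Triality.RotatesFrom.isGenerator_base (h : τ.RotatesFrom M) : IsGenerator 4 Q M.1 :=
  ⟨M.2.1, h.dim_eq_four⟩

theorem Triality.RotatesFrom.isGenerator_toPerm (h : τ.RotatesFrom M) {x : Element Q}
    (hx : x.dim = 1) : IsGenerator 4 Q (τ.toPerm x).1 :=
  ⟨(τ.toPerm x).2.1, ((h.dim_eq_one_iff x).1 hx).1⟩

theorem Triality.RotatesFrom.isGenerator_toPerm_base (h : τ.RotatesFrom M) :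
    IsGenerator 4 Q (τ.toPerm M).1 :=
  ⟨(τ.toPerm M).2.1,
    ((h.sameType_iff M).1 ⟨h.dim_eq_four, h.isGenerator_base.sameType_self⟩).1⟩

variable [FiniteDimensional K V]

theorem isPartialOvoid_iff : IsPartialOvoid Q Ω ↔
    (∀ p ∈ Ω, IsSingularPoint Q p) ∧ ∀ p ∈ Ω, ∀ p' ∈ Ω, p ≤ perp Q p' → p = p' := by
  refine and_congr_right fun hΩ => ⟨fun h p hp p' hp' hpp' => ?_, fun h W hW p hp p' hp' hpW hpW' =>
    h p hp p' hp' fun x hx y hy => hW.prop.polarBilin_eq_zero (hpW' hy) (hpW hx)⟩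
  obtain ⟨W, hle, hW⟩ :=
    exists_maximal_isTotallySingular_ge ((hΩ p' hp').1.sup (hΩ p hp).1 hpp')
  exact h W hW p hp p' hp' (le_sup_right.trans hle) (le_sup_left.trans hle)

theorem Element.incident_iff_le_of_dim_lt {x y : Element Q} (h : x.dim < y.dim) :
    x.Incident y ↔ x.1 ≤ y.1 := by
  refine ⟨?_, Or.inl⟩
  rintro (hle | hle | ⟨hx, hy, -⟩)
  · exact hle
  · exact absurd (finrank_mono hle) h.not_ge
  · exact absurd (hx.trans hy.symm) h.ne

theorem Element.eq_of_le_of_dim_eq {x y : Element Q} (hle : x.1 ≤ y.1) (h : x.dim = y.dim) :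
    x = y :=
  Subtype.ext (eq_of_le_of_finrank_eq hle h)

theorem IsOPlusSpace.sameType_iff_sameType_iff (hV : IsOPlusSpace n Q) (hW : IsGenerator n Q W)
    (hU : IsGenerator n Q U) (hX : IsGenerator n Q X) :
    (SameType n W U ↔ SameType n W X) ↔ SameType n U X := by
  have hparity := hV.finrank_inf_add_mod_two hU hX hW
  unfold SameType Nat.ModEq
  omega

theorem finrank_sup_eq_two (hp : finrank K p = 1) (hp' : finrank K p' = 1) (hne : p ≠ p') :
    finrank K (p ⊔ p' : Submodule K V) = 2 := by
  have hinf : p ⊓ p' = ⊥ :=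
    ((isAtom_iff_finrank_eq_one.2 hp).disjoint_of_ne (isAtom_iff_finrank_eq_one.2 hp') hne).eq_bot
  have hsum := finrank_inf_add_finrank_sup p p'
  rwa [hinf, finrank_bot, zero_add, hp, hp'] at hsum

namespace Triality.RotatesFrom

variable {x y : Element Q}

theorem toPerm_le_toPerm_iff (h : τ.RotatesFrom M) (hx : x.dim = 1) (hy : 1 < y.dim)
    (hτy : (τ.toPerm y).dim < 4) : (τ.toPerm y).1 ≤ (τ.toPerm x).1 ↔ x.1 ≤ y.1 := by
  rw [← Element.incident_iff_le_of_dim_lt (hτy.trans_eq (h.isGenerator_toPerm hx).finrank_eq.symm),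
    ← Element.incident_iff_le_of_dim_lt (hx.trans_lt hy), Element.incident_comm, τ.incident_iff]

theorem sameType_toPerm_toPerm (h : τ.RotatesFrom M) (hV : IsOPlusSpace 4 Q) (hx : x.dim = 1)
    (hy : y.dim = 1) : SameType 4 (τ.toPerm x).1 (τ.toPerm y).1 :=
  (hV.sameType_iff_sameType_iff h.isGenerator_base (h.isGenerator_toPerm hx)
    (h.isGenerator_toPerm hy)).1
    (iff_of_true ((h.dim_eq_one_iff x).1 hx).2 ((h.dim_eq_one_iff y).1 hy).2)

theorem finrank_toPerm_inf_eq_zero_or_two (h : τ.RotatesFrom M) (hV : IsOPlusSpace 4 Q)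
    (hx : x.dim = 1) (hy : y.dim = 1) (hne : x ≠ y) :
    finrank K ((τ.toPerm x).1 ⊓ (τ.toPerm y).1 : Submodule K V) = 0 ∨
      finrank K ((τ.toPerm x).1 ⊓ (τ.toPerm y).1 : Submodule K V) = 2 := by
  have hτx := (h.isGenerator_toPerm hx).finrank_eq
  have hτy := (h.isGenerator_toPerm hy).finrank_eq
  have hparity := h.sameType_toPerm_toPerm hV hx hy
  have hle := finrank_mono (inf_le_left : (τ.toPerm x).1 ⊓ (τ.toPerm y).1 ≤ (τ.toPerm x).1)
  have hfour : finrank K ((τ.toPerm x).1 ⊓ (τ.toPerm y).1 : Submodule K V) ≠ 4 := fun hinf =>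
    hne (τ.toPerm.injective (Element.eq_of_le_of_dim_eq
      (inf_eq_left.1 (eq_of_le_of_finrank_eq inf_le_left (hinf.trans hτx.symm)))
      (hτx.trans hτy.symm)))
  unfold SameType Nat.ModEq at hparity
  omega

theorem finrank_toPerm_inf_eq_two_iff (h : τ.RotatesFrom M) (hV : IsOPlusSpace 4 Q)
    (hx : x.dim = 1) (hy : y.dim = 1) (hne : x ≠ y) :
    finrank K ((τ.toPerm x).1 ⊓ (τ.toPerm y).1 : Submodule K V) = 2 ↔ x.1 ≤ perp Q y.1 := by
  constructor
  · intro hinf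
    obtain ⟨L, hL⟩ := τ.toPerm.surjective
      ⟨_, (τ.toPerm x).2.1.mono (inf_le_left : (τ.toPerm x).1 ⊓ (τ.toPerm y).1 ≤ _),
        Or.inr (Or.inl hinf)⟩
    have hτL : (τ.toPerm L).dim = 2 := by rwa [hL]
    have hLdim : L.dim = 2 := (h.dim_eq_two_iff L).1 hτL
    have hτL_le : (τ.toPerm L).1 ≤ (τ.toPerm x).1 ⊓ (τ.toPerm y).1 := by rw [hL]
    have hxL := (h.toPerm_le_toPerm_iff hx (y := L) (by omega) (by omega)).1
      (hτL_le.trans inf_le_left)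
    have hyL := (h.toPerm_le_toPerm_iff hy (y := L) (by omega) (by omega)).1
      (hτL_le.trans inf_le_right)
    exact fun u hu v hv => L.2.1.polarBilin_eq_zero (hyL hv) (hxL hu)
  · intro hperp
    have hsup : finrank K (y.1 ⊔ x.1 : Submodule K V) = 2 :=
      finrank_sup_eq_two hy hx fun heq => hne (Subtype.ext heq.symm)
    let L : Element Q := ⟨y.1 ⊔ x.1, y.2.1.sup x.2.1 hperp, Or.inr (Or.inl hsup)⟩
    have hL : L.dim = 2 := hsup
    have hτL : (τ.toPerm L).dim = 2 := (h.dim_eq_two_iff L).2 hL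
    have hle : finrank K (τ.toPerm L).1 ≤ _ := finrank_mono (le_inf
      ((h.toPerm_le_toPerm_iff hx (by omega) (by omega)).2 (le_sup_right : x.1 ≤ L.1))
      ((h.toPerm_le_toPerm_iff hy (by omega) (by omega)).2 (le_sup_left : y.1 ≤ L.1)))
    refine (h.finrank_toPerm_inf_eq_zero_or_two hV hx hy hne).resolve_left fun hzero => ?_
    exact two_ne_zero (Nat.le_zero.1 (hτL.ge.trans (hle.trans hzero.le)))

theorem toPerm_inf_ne_bot_iff (h : τ.RotatesFrom M) (hV : IsOPlusSpace 4 Q) (hx : x.dim = 1)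
    (hy : y.dim = 1) : (τ.toPerm x).1 ⊓ (τ.toPerm y).1 ≠ ⊥ ↔ x.1 ≤ perp Q y.1 := by
  obtain rfl | hne := eq_or_ne x y
  · rw [inf_idem]
    have hpos : 0 < finrank K (τ.toPerm x).1 := by
      rw [(h.isGenerator_toPerm hx).finrank_eq]
      exact four_pos
    exact iff_of_true (ne_bot_of_finrank_pos hpos) x.2.1.le_perp
  · rw [← h.finrank_toPerm_inf_eq_two_iff hV hx hy hne, Ne, ← finrank_eq_zero (R := K)]
    have := h.finrank_toPerm_inf_eq_zero_or_two hV hx hy hne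
    omega

theorem isOrthogonalPartialSpread_image (h : τ.RotatesFrom M) (hV : IsOPlusSpace 4 Q)
    (hΩ : IsPartialOvoid Q Ω) : IsOrthogonalPartialSpread 4 Q (τ.image Ω) := by
  rw [isPartialOvoid_iff] at hΩ
  refine ⟨⟨?_, ?_⟩, ?_⟩
  · rintro _ ⟨x, hx, rfl⟩
    exact (h.isGenerator_toPerm (hΩ.1 _ hx).2).finrank_eq
  · rintro _ ⟨x, hx, rfl⟩ _ ⟨y, hy, rfl⟩ hne
    by_contra hinf
    have hperp := (h.toPerm_inf_ne_bot_iff hV (hΩ.1 _ hx).2 (hΩ.1 _ hy).2).1 hinf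
    exact hne (by rw [Subtype.ext (hΩ.2 _ hx _ hy hperp)])
  · rintro _ ⟨x, -, rfl⟩
    exact (τ.toPerm x).2.1

theorem sameType_toPerm_base_iff (h : τ.RotatesFrom M) (hV : IsOPlusSpace 4 Q)
    (hW : IsGenerator 4 Q W) : SameType 4 (τ.toPerm M).1 W ↔ ¬ SameType 4 M.1 W := by
  have htype : ¬ SameType 4 M.1 (τ.toPerm M).1 :=
    ((h.sameType_iff M).1 ⟨h.dim_eq_four, h.isGenerator_base.sameType_self⟩).2
  have := hV.sameType_iff_sameType_iff h.isGenerator_base h.isGenerator_toPerm_base hW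
  tauto

theorem exists_symm (h : τ.RotatesFrom M) (hV : IsOPlusSpace 4 Q) :
    ∃ σ : Triality Q, σ.RotatesFrom (τ.toPerm M) := by
  have htype (x : Element Q) (hx : x.dim = 4) :
      SameType 4 (τ.toPerm M).1 x.1 ↔ ¬ SameType 4 M.1 x.1 :=
    h.sameType_toPerm_base_iff hV ⟨x.2.1, hx⟩
  have hrot (x : Element Q) :
      (x.dim = 1 ↔ (τ.toPerm.symm x).dim = 4 ∧
        SameType 4 (τ.toPerm M).1 (τ.toPerm.symm x).1) ∧
      ((x.dim = 4 ∧ SameType 4 (τ.toPerm M).1 x.1) ↔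
        (τ.toPerm.symm x).dim = 4 ∧ ¬ SameType 4 (τ.toPerm M).1 (τ.toPerm.symm x).1) ∧
      ((x.dim = 4 ∧ ¬ SameType 4 (τ.toPerm M).1 x.1) ↔ (τ.toPerm.symm x).dim = 1) := by
    have hpoint := h.dim_eq_one_iff (τ.toPerm.symm x)
    have hsame := h.sameType_iff (τ.toPerm.symm x)
    have hother := h.not_sameType_iff (τ.toPerm.symm x)
    rw [Equiv.apply_symm_apply] at hpoint hsame hother
    refine ⟨?_, ?_, ?_⟩
    · rw [← hother, and_congr_right (htype _)]
    · rw [and_congr_right (htype x), ← hsame,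
        and_congr_right fun hx => not_iff_comm.1 (htype _ hx).symm]
    · rw [hpoint, and_congr_right fun hx => not_iff_comm.1 (htype x hx).symm]
  refine ⟨⟨τ.toPerm.symm, fun x y => ?_, _, h.isGenerator_toPerm_base.finrank_eq, hrot⟩,
    h.isGenerator_toPerm_base.finrank_eq, fun x => (hrot x).1, fun x => (hrot x).2.1,
    fun x => (hrot x).2.2⟩
  rw [← τ.incident_iff, Equiv.apply_symm_apply, Equiv.apply_symm_apply]

theorem exists_not_sameType (hV : IsOPlusSpace 4 Q) (hW : IsGenerator 4 Q W) :
    ∃ (τ : Triality Q) (M : Element Q), τ.RotatesFrom M ∧ ¬ SameType 4 M.1 W := by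
  obtain ⟨τ⟩ := hV.nonempty_triality
  obtain ⟨M, h⟩ := τ.exists_rotatesFrom
  by_cases hM : SameType 4 M.1 W
  · obtain ⟨σ, hσ⟩ := h.exists_symm hV
    exact ⟨σ, _, hσ, fun hσW => (h.sameType_toPerm_base_iff hV hW).1 hσW hM⟩
  · exact ⟨τ, M, h, hM⟩

end Triality.RotatesFrom

end Triality

section Ovoids

variable {K : Type u} [Field K] {V : Type v} [AddCommGroup V] [Module K V]
  {Q : QuadraticForm K V} {τ : Triality Q} {M : Element Q} {Ω : Set (Submodule K V)}
  {a b : Submodule K V} {v : V} {n : ℕ}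

theorem Triality.setOf_mem_image_subset :
    {v : V | v ≠ 0 ∧ ∃ W ∈ τ.image Ω, v ∈ W} ⊆ {v : V | v ≠ 0 ∧ Q v = 0} := by
  rintro v ⟨hv, _, ⟨x, -, rfl⟩, hvx⟩
  exact ⟨hv, (τ.toPerm x).2.1 v hvx⟩

theorem maximal_of_forall_exists_inf_ne_bot {P : Set (Submodule K V) → Prop}
    (hP : ∀ T, P T → IsPartialSpread n T) {S : Set (Submodule K V)} (hS : P S)
    (hmeet : ∀ T, P T → ∀ W ∈ T, ∃ U ∈ S, W ⊓ U ≠ ⊥) : Maximal P S := by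
  refine ⟨hS, fun T hT hle W hW => ?_⟩
  obtain ⟨U, hU, hWU⟩ := hmeet T hT W hW
  by_contra hWS
  exact hWU ((hP T hT).2 W hW U (hle hU) fun heq => hWS (heq ▸ hU))

theorem linearIndependent_of_polarBilin_eq_one {ι : Type*} {v : ι → V}
    (hsingular : ∀ i, Q (v i) = 0) (hpolar : Pairwise fun i j => Q.polarBilin (v i) (v j) = 1)
    (i₀ : ι) :
    LinearIndependent K fun i : {i // i ≠ i₀} => v i := by
  classical
  rw [linearIndependent_iff']
  intro s c hsum i hi
  have hpair (j : ι) : ∑ k ∈ s, c k * Q.polarBilin (v k) (v j) = 0 := by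
    simpa only [map_sum, map_smul, LinearMap.sum_apply, LinearMap.smul_apply, smul_eq_mul, map_zero,
      LinearMap.zero_apply] using congrArg (fun x => Q.polarBilin x (v j)) hsum
  have hzero : ∑ k ∈ s, c k = 0 := by
    rw [← hpair i₀]
    exact Finset.sum_congr rfl fun k _ => by rw [hpolar k.2, mul_one]
  have hself : Q.polarBilin (v i) (v i) = 0 :=
    (isTotallySingular_span_singleton (hsingular i)).polarBilin_eq_zero
      (mem_span_singleton_self _) (mem_span_singleton_self _)
  have hother : ∑ k ∈ s.erase i, c k = 0 := by
    rw [← hpair i, ← Finset.add_sum_erase s _ hi, hself, mul_zero, zero_add]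
    refine Finset.sum_congr rfl fun k hk => ?_
    rw [hpolar (Subtype.coe_ne_coe.2 (Finset.ne_of_mem_erase hk)), mul_one]
  rwa [← Finset.add_sum_erase s c hi, hother, add_zero] at hzero

variable [FiniteDimensional K V]

theorem IsPartialOvoid.exchange (hΩ : IsPartialOvoid Q Ω) (ha : IsSingularPoint Q a) :
    IsPartialOvoid Q (exchange Q Ω a) := by
  rw [isPartialOvoid_iff] at hΩ ⊢
  refine ⟨?_, ?_⟩
  · rintro p (⟨hp, -⟩ | rfl)
    · exact hΩ.1 p hp
    · exact ha
  · rintro p (⟨hp, hpa⟩ | rfl) p' (⟨hp', hpa'⟩ | rfl) hperp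
    · exact hΩ.2 p hp p' hp' hperp
    · exact absurd ⟨hp, hperp⟩ hpa
    · exact absurd ⟨hp', le_perp_comm.1 hperp⟩ hpa'
    · rfl

theorem maximal_isPartialOvoid_iff : Maximal (IsPartialOvoid Q) Ω ↔
    IsPartialOvoid Q Ω ∧ ∀ b, IsSingularPoint Q b → ∃ p ∈ Ω, p ≤ perp Q b := by
  refine and_congr_right fun hΩ => ⟨fun hmax b hb => ?_, fun h T hT hle b hbT => ?_⟩
  · by_contra! hperp
    have hdiff : exchange Q Ω b = insert b Ω := by
      have hempty : perpInter Q Ω b = ∅ :=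
        Set.eq_empty_of_forall_notMem fun p hp => hperp p hp.1 hp.2
      rw [PolarSpread.exchange, hempty, Set.sdiff_empty, Set.union_singleton]
    have hbΩ : b ∈ Ω := hmax (hdiff ▸ hΩ.exchange hb) (Set.subset_insert b Ω)
      (Set.mem_insert b Ω)
    exact hperp b hbΩ hb.1.le_perp
  · rw [isPartialOvoid_iff] at hT
    obtain ⟨p, hp, hpb⟩ := h b (hT.1 b hbT)
    exact hT.2 p (hle hp) b hbT hpb ▸ hp

namespace Triality.RotatesFrom

theorem exists_mem_image_iff (h : τ.RotatesFrom M) (hΩ : ∀ p ∈ Ω, IsSingularPoint Q p)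
    {x : Element Q} (hv : v ≠ 0) (hx : (τ.toPerm x).1 = span K {v}) :
    (∃ W ∈ τ.image Ω, v ∈ W) ↔ ∃ p ∈ Ω, p ≤ x.1 := by
  have hτx : (τ.toPerm x).dim = 1 := by
    rw [Element.dim, hx, finrank_span_singleton hv]
  have hxdim : x.dim = 4 := ((h.not_sameType_iff x).2 hτx).1
  have hmem {y : Element Q} (hy : y.dim = 1) : v ∈ (τ.toPerm y).1 ↔ y.1 ≤ x.1 := by
    rw [← h.toPerm_le_toPerm_iff hy (by omega) (by omega), hx, span_singleton_le_iff_mem]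
  constructor
  · rintro ⟨_, ⟨y, hy, rfl⟩, hvy⟩
    exact ⟨y.1, hy, (hmem (hΩ _ hy).2).1 hvy⟩
  · rintro ⟨p, hp, hpx⟩
    exact ⟨_, ⟨(hΩ p hp).element, hp, rfl⟩, (hmem (hΩ p hp).dim_element).2 hpx⟩

theorem exists_mem_image (h : τ.RotatesFrom M) (hV : IsOPlusSpace 4 Q) (hΩ : IsOvoid Q Ω)
    (hv : v ≠ 0) (hQv : Q v = 0) : ∃ W ∈ τ.image Ω, v ∈ W := by
  have hpoint : IsSingularPoint Q (span K {v}) := isSingularPoint_iff.2 ⟨v, hv, hQv, rfl⟩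
  obtain ⟨x, hx⟩ := τ.toPerm.surjective hpoint.element
  have hxdim := ((h.not_sameType_iff x).2 (hx ▸ hpoint.2)).1
  rw [h.exists_mem_image_iff hΩ.1.1 hv (congrArg Subtype.val hx)]
  exact hΩ.2 x.1 (hV.maximal_iff.2 ⟨x.2.1, hxdim⟩)

theorem exists_mem_image_inf_ne_bot (h : τ.RotatesFrom M) (hV : IsOPlusSpace 4 Q)
    (hΩ : Maximal (IsPartialOvoid Q) Ω) {W : Submodule K V} (hW : IsGenerator 4 Q W) :
    ∃ U ∈ τ.image Ω, W ⊓ U ≠ ⊥ := by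
  obtain ⟨⟨hsingular, -⟩, hperp⟩ := maximal_isPartialOvoid_iff.1 hΩ
  by_cases htype : SameType 4 M.1 W
  · obtain ⟨x, hx⟩ := τ.toPerm.surjective hW.element
    have hxdim : x.dim = 1 := (h.dim_eq_one_iff x).2 (hx ▸ ⟨hW.finrank_eq, htype⟩)
    obtain ⟨p, hp, hpx⟩ := hperp x.1 ⟨x.2.1, hxdim⟩
    refine ⟨_, ⟨(hsingular p hp).element, hp, rfl⟩, ?_⟩
    have hinf := (h.toPerm_inf_ne_bot_iff hV (hsingular p hp).dim_element hxdim).2 hpx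
    rwa [hx, inf_comm] at hinf
  · have hpoint := (h.not_sameType_iff hW.element).1 ⟨hW.finrank_eq, htype⟩
    obtain ⟨p, hp, -⟩ := hperp _ ⟨(τ.toPerm hW.element).2.1, hpoint⟩
    refine ⟨_, ⟨(hsingular p hp).element, hp, rfl⟩, fun hinf => ?_⟩
    have hτp := h.isGenerator_toPerm (hsingular p hp).dim_element
    have hiff := hV.sameType_iff_sameType_iff h.isGenerator_base hW hτp
    have hp_type := ((h.dim_eq_one_iff (hsingular p hp).element).1 (hsingular p hp).dim_element).2
    have hdisjoint : SameType 4 W (τ.toPerm (hsingular p hp).element).1 := by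
      rw [SameType, hinf, finrank_bot]
      rfl
    exact htype ((hiff.2 hdisjoint).2 hp_type)

end Triality.RotatesFrom

theorem Triality.RotatesFrom.maximal_orthogonal_image (h : τ.RotatesFrom M)
    (hV : IsOPlusSpace 4 Q) (hΩ : Maximal (IsPartialOvoid Q) Ω) :
    Maximal (IsOrthogonalPartialSpread 4 Q) (τ.image Ω) :=
  maximal_of_forall_exists_inf_ne_bot (fun _ hT => hT.1)
    (h.isOrthogonalPartialSpread_image hV hΩ.prop)
    fun _ hT W hW => h.exists_mem_image_inf_ne_bot hV hΩ ⟨hT.2 W hW, hT.1.1 W hW⟩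

theorem IsOPlusSpace.exists_isGenerator_sameType (hV : IsOPlusSpace n Q) {G H : Submodule K V}
    (hG : IsGenerator n Q G) (hH : IsTotallySingular Q H) (hHn : finrank K H + 1 = n) :
    ∃ W, IsGenerator n Q W ∧ SameType n G W ∧ H ≤ W := by
  obtain ⟨U, hHU, hmax⟩ := exists_maximal_isTotallySingular_ge hH
  have hU := hV.maximal_iff.1 hmax
  by_cases hGU : SameType n G U
  · exact ⟨U, hU, hGU, hHU⟩
  obtain ⟨U', hU', hcompl⟩ := hV.exists_isCompl_isGenerator hU
  have hperp_inf : perp Q H ⊓ U' ≠ ⊥ := fun hbot => by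
    have hperp := hV.finrank_perp H
    have hsum := finrank_inf_add_finrank_sup (perp Q H) U'
    have hle := Submodule.finrank_le (perp Q H ⊔ U')
    rw [hbot, finrank_bot, hU'.finrank_eq] at hsum
    rw [hV.finrank_eq] at hle
    omega
  obtain ⟨z, ⟨hzH, hzU'⟩, hz⟩ := exists_mem_ne_zero_of_ne_bot hperp_inf
  have hzU : z ∉ U := fun hzU => hz (disjoint_def.1 hcompl.disjoint z hzU hzU')
  obtain ⟨W, hW, -, hWU, hle⟩ := hV.exists_adjacent_mem hU (hU'.isTotallySingular z hzU') hzU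
  refine ⟨W, hW, ?_, (le_inf hHU ?_).trans hle⟩
  · have hiff := hV.sameType_iff_sameType_iff hG hU hW
    have hUW : ¬ SameType n U W := by
      rw [SameType, inf_comm, ← hWU]
      exact fun hmod => by simp [Nat.ModEq] at hmod; omega
    tauto
  · rwa [le_perp_comm, span_singleton_le_iff_mem]

variable [Finite K]

theorem exists_isTotallySingular_hyperplane [CharP K 2] {W : Submodule K V}
    (hW : IsTotallyIsotropic Q.polarBilin W) :
    ∃ H ≤ W, IsTotallySingular Q H ∧ finrank K W ≤ finrank K H + 1 := by
  have hadd {x y : V} (hx : x ∈ W) (hy : y ∈ W) : Q (x + y) = Q x + Q y := by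
    rw [map_add_polarBilin, hW x hx y hy, add_zero]
  let H : Submodule K V :=
    { carrier := {x | x ∈ W ∧ Q x = 0}
      add_mem' := fun {x y} hx hy =>
        ⟨add_mem hx.1 hy.1, by rw [hadd hx.1 hy.1, hx.2, hy.2, add_zero]⟩
      zero_mem' := ⟨zero_mem W, QuadraticMap.map_zero Q⟩
      smul_mem' := fun c x hx =>
        ⟨smul_mem W c hx.1, by rw [QuadraticMap.map_smul, hx.2, smul_zero]⟩ }
  refine ⟨H, fun x hx => hx.1, fun x hx => hx.2, ?_⟩
  by_cases hsingular : IsTotallySingular Q W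
  · exact (finrank_mono fun x hx => ⟨hx, hsingular x hx⟩ : finrank K W ≤ finrank K H).trans
      (Nat.le_succ _)
  obtain ⟨x, hx, hQx⟩ : ∃ x ∈ W, Q x ≠ 0 := by simpa [IsTotallySingular] using hsingular
  have hle : W ≤ H ⊔ span K {x} := fun y hy => by
    obtain ⟨c, hc⟩ : IsSquare (Q y / Q x) :=
      FiniteField.isSquare_of_char_two (ringChar.eq_iff.2 inferInstance) _
    have hmem : y + c • x ∈ H := by
      refine ⟨add_mem hy (smul_mem W c hx), ?_⟩
      rw [hadd hy (smul_mem W c hx), QuadraticMap.map_smul, ← hc, smul_eq_mul,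
        div_mul_cancel₀ _ hQx, CharTwo.add_self_eq_zero]
    rw [← add_sub_cancel_right y (c • x)]
    exact sub_mem (mem_sup_left hmem) (mem_sup_right (mem_span_singleton.2 ⟨c, rfl⟩))
  have hsum := finrank_add_le_finrank_add_finrank H (span K {x})
  have hspan : finrank K (span K {x}) ≤ 1 := (finrank_span_le_card {x}).trans (by simp)
  exact (finrank_mono hle).trans (hsum.trans (Nat.add_le_add_left hspan _))

namespace Triality.RotatesFrom

theorem exists_mem_image_inf_ne_bot_of_isTotallyIsotropic [CharP K 2] (h : τ.RotatesFrom M)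
    (hV : IsOPlusSpace 4 Q) (hΩ : Maximal (IsPartialOvoid Q) Ω) {W : Submodule K V}
    (hW : IsTotallyIsotropic Q.polarBilin W) (hWdim : finrank K W = 4) :
    ∃ U ∈ τ.image Ω, W ⊓ U ≠ ⊥ := by
  obtain ⟨H, hHW, hH, hHdim⟩ := exists_isTotallySingular_hyperplane hW
  suffices ∃ U ∈ τ.image Ω, H ⊓ U ≠ ⊥ by
    obtain ⟨U, hU, hHU⟩ := this
    exact ⟨U, hU, ne_bot_of_le_ne_bot hHU (inf_le_inf_right U hHW)⟩
  have hHle := hV.finrank_le hH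
  obtain hH4 | hH3 : finrank K H = 4 ∨ finrank K H + 1 = 4 := by omega
  · exact h.exists_mem_image_inf_ne_bot hV hΩ ⟨hH, hH4⟩
  obtain ⟨E, hE, htype, hHE⟩ := hV.exists_isGenerator_sameType h.isGenerator_base hH hH3
  obtain ⟨_, ⟨x, hx, rfl⟩, hinf⟩ := h.exists_mem_image_inf_ne_bot hV hΩ hE
  refine ⟨_, ⟨x, hx, rfl⟩, fun hbot => ?_⟩
  have hxdim := (hΩ.prop.1 _ hx).2
  have hmod := (hV.sameType_iff_sameType_iff h.isGenerator_base hE (h.isGenerator_toPerm hxdim)).1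
    (iff_of_true htype ((h.dim_eq_one_iff x).1 hxdim).2)
  have hpos := one_le_finrank_iff.2 hinf
  have hsum := finrank_inf_add_finrank_sup H (E ⊓ (τ.toPerm x).1)
  have hle := (finrank_mono (sup_le hHE inf_le_left :
    H ⊔ E ⊓ (τ.toPerm x).1 ≤ E)).trans_eq hE.finrank_eq
  rw [← inf_assoc, inf_eq_left.2 hHE, hbot, finrank_bot] at hsum
  unfold SameType Nat.ModEq at hmod
  omega

theorem maximal_symplectic_image [CharP K 2] (h : τ.RotatesFrom M) (hV : IsOPlusSpace 4 Q)
    (hΩ : Maximal (IsPartialOvoid Q) Ω) :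
    Maximal (IsSymplecticPartialSpread 4 Q.polarBilin) (τ.image Ω) := by
  have hspread := h.isOrthogonalPartialSpread_image hV hΩ.prop
  exact maximal_of_forall_exists_inf_ne_bot (fun _ hT => hT.1)
    ⟨hspread.1, fun W hW x hx y hy => (hspread.2 W hW).polarBilin_eq_zero hx hy⟩
    fun _ hT W hW => h.exists_mem_image_inf_ne_bot_of_isTotallyIsotropic hV hΩ (hT.2 W hW)
      (hT.1.1 W hW)

theorem ncard_mem_image (h : τ.RotatesFrom M) (hV : IsOPlusSpace 4 Q)
    (hΩ : IsPartialOvoid Q Ω) :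
    {v : V | v ≠ 0 ∧ ∃ W ∈ τ.image Ω, v ∈ W}.ncard = Ω.ncard * (Nat.card K ^ 4 - 1) := by
  have hspread := (h.isOrthogonalPartialSpread_image hV hΩ).1
  have hncard := ncard_ne_zero_mem_of_pairwise_inf_eq_bot (A := ⊤)
    (fun W hW => by rw [inf_top_eq]; exact hspread.1 W hW) hspread.2
  simpa only [mem_top, true_and, τ.ncard_image hΩ.1] using hncard

end Triality.RotatesFrom

theorem IsPartialOvoid.isOvoid_of_ncard (hΩ : IsPartialOvoid Q Ω) (hV : IsOPlusSpace 4 Q)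
    (hcard : Ω.ncard = Nat.card K ^ 3 + 1) : IsOvoid Q Ω := by
  have := finite_of_finite K (M := V)
  refine ⟨hΩ, fun W hmax => ?_⟩
  have hW := hV.maximal_iff.1 hmax
  obtain ⟨τ, M, h, htype⟩ := Triality.RotatesFrom.exists_not_sameType hV hW
  have hcover := Set.eq_of_subset_of_ncard_le (Triality.setOf_mem_image_subset (τ := τ) (Ω := Ω))
    (by rw [hV.ncard_singular, h.ncard_mem_image hV hΩ, hcard])
  have hpoint := (h.not_sameType_iff hW.element).1 ⟨hW.finrank_eq, htype⟩
  obtain ⟨v, hv, hQv, hτW⟩ := isSingularPoint_iff.1 ⟨(τ.toPerm hW.element).2.1, hpoint⟩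
  exact (h.exists_mem_image_iff hΩ.1 hv hτW).1 (hcover.ge ⟨hv, hQv⟩).2

theorem IsOvoid.ncard_eq (hΩ : IsOvoid Q Ω) (hV : IsOPlusSpace 4 Q) :
    Ω.ncard = Nat.card K ^ 3 + 1 := by
  obtain ⟨τ⟩ := hV.nonempty_triality
  obtain ⟨M, h⟩ := τ.exists_rotatesFrom
  have hcover : {v : V | v ≠ 0 ∧ ∃ W ∈ τ.image Ω, v ∈ W} = {v : V | v ≠ 0 ∧ Q v = 0} :=
    Triality.setOf_mem_image_subset.antisymm fun v hv =>
      ⟨hv.1, h.exists_mem_image hV hΩ hv.1 hv.2⟩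
  have hncard := h.ncard_mem_image hV hΩ.1
  rw [hcover, hV.ncard_singular] at hncard
  exact (Nat.eq_of_mul_eq_mul_right
    (Nat.sub_pos_of_lt (Nat.one_lt_pow four_ne_zero Finite.one_lt_card)) hncard).symm

theorem IsOvoid.ncard_perpInter (hΩ : IsOvoid Q Ω) (hV : IsOPlusSpace 4 Q)
    (ha : IsSingularPoint Q a) (haΩ : a ∉ Ω) :
    (perpInter Q Ω a).ncard = Nat.card K ^ 2 + 1 := by
  obtain ⟨τ⟩ := hV.nonempty_triality
  obtain ⟨M, h⟩ := τ.exists_rotatesFrom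
  have hpartial := isPartialOvoid_iff.1 hΩ.1
  have hP : IsPartialOvoid Q (perpInter Q Ω a) := isPartialOvoid_iff.2
    ⟨fun p hp => hpartial.1 p hp.1, fun p hp p' hp' => hpartial.2 p hp.1 p' hp'.1⟩
  let A := (τ.toPerm ha.element).1
  have hA : finrank K A = 4 := (h.isGenerator_toPerm ha.dim_element).finrank_eq
  have hline : ∀ W ∈ τ.image (perpInter Q Ω a), finrank K (W ⊓ A : Submodule K V) = 2 := by
    rintro _ ⟨x, hx, rfl⟩
    exact (h.finrank_toPerm_inf_eq_two_iff hV (hP.1 _ hx).2 ha.dim_element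
      (by rintro rfl; exact haΩ hx.1)).2 hx.2
  have hcover : {v : V | v ≠ 0 ∧ v ∈ A ∧ ∃ W ∈ τ.image (perpInter Q Ω a), v ∈ W} =
      {v : V | v ≠ 0 ∧ v ∈ A} := by
    refine Set.Subset.antisymm (fun v hv => ⟨hv.1, hv.2.1⟩) fun v hv => ⟨hv.1, hv.2, ?_⟩
    obtain ⟨_, ⟨x, hx, rfl⟩, hvx⟩ :=
      h.exists_mem_image hV hΩ hv.1 ((τ.toPerm ha.element).2.1 v hv.2)
    have hinf : (τ.toPerm x).1 ⊓ A ≠ ⊥ := (Submodule.ne_bot_iff _).2 ⟨v, ⟨hvx, hv.2⟩, hv.1⟩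
    have hperp := (h.toPerm_inf_ne_bot_iff hV (hpartial.1 _ hx).2 ha.dim_element).1 hinf
    exact ⟨_, ⟨x, ⟨hx, hperp⟩, rfl⟩, hvx⟩
  have hncard := ncard_ne_zero_mem_of_pairwise_inf_eq_bot hline
    (h.isOrthogonalPartialSpread_image hV hP).1.2
  rw [hcover, ncard_ne_zero_mem, hA, τ.ncard_image hP.1, show 4 = 2 * 2 from rfl, pow_mul] at hncard
  refine Nat.eq_of_mul_eq_mul_right
    (Nat.sub_pos_of_lt (Nat.one_lt_pow two_ne_zero (Finite.one_lt_card (α := K)))) ?_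
  rw [← hncard]
  exact Nat.sq_sub_sq (Nat.card K ^ 2) 1

theorem IsOvoid.ncard_exchange (hΩ : IsOvoid Q Ω) (hV : IsOPlusSpace 4 Q)
    (ha : IsSingularPoint Q a) (haΩ : a ∉ Ω) :
    ((exchange Q Ω a).ncard : ℤ) = (Nat.card K : ℤ) ^ 3 - (Nat.card K : ℤ) ^ 2 + 1 := by
  have := finite_of_finite K (M := V)
  have hdiff := Set.ncard_sdiff_add_ncard_of_subset (fun p hp => hp.1 : perpInter Q Ω a ⊆ Ω)
  rw [hΩ.ncard_eq hV, hΩ.ncard_perpInter hV ha haΩ] at hdiff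
  rw [exchange, Set.ncard_union_eq (Set.disjoint_singleton_right.2 fun ha => haΩ ha.1),
    Set.ncard_singleton]
  zify at hdiff
  push_cast
  linarith

theorem IsOvoid.perpInter_eq_of_subset (hΩ : IsOvoid Q Ω) (hV : IsOPlusSpace 4 Q)
    (ha : IsSingularPoint Q a) (haΩ : a ∉ Ω) (hb : IsSingularPoint Q b) (hbΩ : b ∉ Ω)
    (hsub : perpInter Q Ω b ⊆ perpInter Q Ω a) : perpInter Q Ω b = perpInter Q Ω a := by
  have := finite_of_finite K (M := V)
  refine Set.eq_of_subset_of_ncard_le hsub ?_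
  rw [hΩ.ncard_perpInter hV ha haΩ, hΩ.ncard_perpInter hV hb hbΩ]

theorem IsExchangePoint.maximal_exchange (ha : IsExchangePoint Q Ω a) (hΩ : IsOvoid Q Ω)
    (hV : IsOPlusSpace 4 Q) : Maximal (IsPartialOvoid Q) (exchange Q Ω a) := by
  refine maximal_isPartialOvoid_iff.2 ⟨hΩ.1.exchange ha.isSingularPoint, fun b hb => ?_⟩
  by_contra! hperp
  have hsub : perpInter Q Ω b ⊆ perpInter Q Ω a := fun p hp => by
    by_contra hpa
    exact hperp p (Or.inl ⟨hp.1, hpa⟩) hp.2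
  have hba : ¬ b ≤ perp Q a := fun hba => hperp a (Or.inr rfl) (le_perp_comm.1 hba)
  have hbΩ : b ∉ Ω := fun hbΩ => hba (hsub ⟨hbΩ, hb.1.le_perp⟩).2
  have hperpInter := hΩ.perpInter_eq_of_subset hV ha.isSingularPoint ha.notMem hb hbΩ hsub
  have hb_eq : b = a := ha.unique b hb
    (le_perp_comm.1 (sSup_le fun p hp => (hperpInter.ge hp).2))
  exact hba (hb_eq ▸ hb.1.le_perp)

theorem eq_one_of_card_eq_two (hK : Nat.card K = 2) {c : K} (hc : c ≠ 0) : c = 1 := by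
  have := Fintype.ofFinite K
  simpa [← Nat.card_eq_fintype_card, hK] using FiniteField.pow_card_sub_one_eq_one c hc

theorem IsOvoid.sSup_eq_top_of_card_eq_two (hΩ : IsOvoid Q Ω) (hV : IsOPlusSpace 4 Q)
    (hK : Nat.card K = 2) : sSup Ω = ⊤ := by
  have hpartial := isPartialOvoid_iff.1 hΩ.1
  choose v _ hQv hspan using fun p : Ω => isSingularPoint_iff.1 (hpartial.1 p p.2)
  have hpolar : Pairwise fun p p' => Q.polarBilin (v p) (v p') = 1 := fun p p' hne => by
    refine eq_one_of_card_eq_two hK fun hzero => hne (Subtype.ext ?_)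
    refine (hpartial.2 p' p'.2 p p.2 ?_).symm
    rwa [hspan p, hspan p', span_singleton_le_iff_mem, mem_perp_span_singleton]
  have hcard : Nat.card Ω = 9 := by
    rw [Nat.card_coe_set_eq, hΩ.ncard_eq hV, hK]
    norm_num
  have : Finite Ω := Nat.finite_of_card_ne_zero (by omega)
  have := Fintype.ofFinite Ω
  obtain ⟨p₀⟩ : Nonempty Ω := Finite.card_pos_iff.1 (by omega)
  classical
  have hli := linearIndependent_of_polarBilin_eq_one hQv hpolar p₀
  have htop := hli.span_eq_top_of_card_eq_finrank' (by
    rw [hV.finrank_eq, Fintype.card_subtype_compl, Fintype.card_subtype_eq,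
      ← Nat.card_eq_fintype_card, hcard])
  rw [eq_top_iff, ← htop, span_le]
  rintro _ ⟨p, rfl⟩
  exact le_sSup p.1.2 ((hspan p.1).ge (mem_span_singleton_self _))

theorem IsOvoid.eq_of_perpInter_eq_of_card_eq_two (hΩ : IsOvoid Q Ω) (hV : IsOPlusSpace 4 Q)
    (hK : Nat.card K = 2) (ha : IsSingularPoint Q a) (hb : IsSingularPoint Q b)
    (hab : perpInter Q Ω a = perpInter Q Ω b) : a = b := by
  obtain ⟨x, -, -, rfl⟩ := isSingularPoint_iff.1 ha
  obtain ⟨y, -, -, rfl⟩ := isSingularPoint_iff.1 hb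
  have hpolar : ∀ p ∈ Ω, p ≤ perp Q (span K {x - y}) := fun p hp => by
    obtain ⟨z, -, -, rfl⟩ := isSingularPoint_iff.1 ((isPartialOvoid_iff.1 hΩ.1).1 p hp)
    have hiff : Q.polarBilin x z = 0 ↔ Q.polarBilin y z = 0 := by
      simpa only [perpInter, Set.mem_ofPred_eq, hp, true_and, span_singleton_le_iff_mem,
        mem_perp_span_singleton] using Set.ext_iff.1 hab (span K {z})
    rw [span_singleton_le_iff_mem, mem_perp_span_singleton, map_sub, LinearMap.sub_apply,
      sub_eq_zero]
    by_cases hxz : Q.polarBilin x z = 0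
    · rw [hxz, hiff.1 hxz]
    · rw [eq_one_of_card_eq_two hK hxz, eq_one_of_card_eq_two hK (mt hiff.2 hxz)]
  have htop := (hΩ.sSup_eq_top_of_card_eq_two hV hK).ge.trans (sSup_le hpolar)
  have hsub : x - y = 0 := hV.nondegenerate.1 _ fun z =>
    mem_perp_span_singleton.1 (htop (mem_top : z ∈ ⊤))
  rw [sub_eq_zero.1 hsub]

theorem IsOvoid.isExchangePoint_of_card_eq_two (hΩ : IsOvoid Q Ω) (hV : IsOPlusSpace 4 Q)
    (hK : Nat.card K = 2) (ha : IsSingularPoint Q a) (haΩ : a ∉ Ω) : IsExchangePoint Q Ω a := by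
  refine ⟨ha, haΩ, fun b hb hperp => ?_⟩
  have hsub : perpInter Q Ω a ⊆ perpInter Q Ω b := fun p hp =>
    ⟨hp.1, le_perp_comm.1 (hperp.trans (perp_anti (le_sSup hp)))⟩
  have hbΩ : b ∉ Ω := fun hbΩ => by
    have hsingleton : perpInter Q Ω a ⊆ {b} := fun p hp =>
      (isPartialOvoid_iff.1 hΩ.1).2 p hp.1 b hbΩ (hsub hp).2
    have hle := Set.ncard_le_ncard hsingleton
    rw [hΩ.ncard_perpInter hV ha haΩ, Set.ncard_singleton, hK] at hle
    omega
  have heq := hΩ.perpInter_eq_of_subset hV hb hbΩ ha haΩ hsub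
  exact hΩ.eq_of_perpInter_eq_of_card_eq_two hV hK hb ha heq.symm

end Ovoids

section TraceForm

variable {K : Type u} [Field K] {F : Type w} [Field F] [Algebra K F] {θ : F}

section

variable [FiniteDimensional K F] [Algebra.IsSeparable K F]

theorem eq_zero_of_trace_mul_eq_zero {ι : Type*} {v : ι → F} (hv : span K (Set.range v) = ⊤)
    {c : F} (hc : ∀ i, Algebra.trace K F (c * v i) = 0) : c = 0 := by
  refine (traceForm_nondegenerate K F).1 c fun y => ?_
  have hle : span K (Set.range v) ≤ LinearMap.ker (Algebra.traceForm K F c) := by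
    rw [span_le]
    rintro _ ⟨i, rfl⟩
    exact hc i
  exact hle (hv.ge mem_top)

theorem exists_mem_span_singleton_iff_trace_mul_eq_zero (hF : finrank K F = 3) {x y : F}
    (hxy : LinearIndependent K ![x, y]) :
    ∃ β ≠ 0, ∀ b : F, b ∈ span K {β} ↔
      Algebra.trace K F (b * x) = 0 ∧ Algebra.trace K F (b * y) = 0 := by
  let A := LinearMap.BilinForm.orthogonal (Algebra.traceForm K F) (span K (Set.range ![x, y]))
  have hA : finrank K A = 1 := by
    rw [LinearMap.BilinForm.finrank_orthogonal (traceForm_nondegenerate K F),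
      finrank_span_eq_card hxy, hF, Fintype.card_fin]
  have hmem (b : F) :
      b ∈ A ↔ Algebra.trace K F (b * x) = 0 ∧ Algebra.trace K F (b * y) = 0 := by
    change span K (Set.range ![x, y]) ≤ LinearMap.ker ((Algebra.traceForm K F).flip b) ↔ _
    rw [span_le, Set.range_subset_iff, Fin.forall_fin_two]
    rw [mul_comm b, mul_comm b]
    rfl
  obtain ⟨β, hβ, hβ0⟩ := A.ne_bot_iff.1 (one_le_finrank_iff.1 hA.ge)
  have hspan : span K {β} = A := eq_of_le_of_finrank_eq ((span_singleton_le_iff_mem β A).2 hβ)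
    (by rw [finrank_span_singleton hβ0, hA])
  exact ⟨β, hβ0, fun b => by rw [hspan, hmem]⟩

theorem exists_linearIndependent_one_self_sq (hF : finrank K F = 3) :
    ∃ θ : F, LinearIndependent K ![1, θ, θ ^ 2] := by
  let pb := Field.powerBasisOfFiniteOfSeparable K F
  have hdim : pb.dim = 3 := by rw [← pb.finrank, hF]
  have hli : LinearIndependent K fun i : Fin 3 => pb.gen ^ (i : ℕ) := by
    have hbasis := pb.basis.linearIndependent.comp (Fin.cast hdim.symm) (Fin.cast_injective _)
    rwa [pb.coe_basis] at hbasis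
  refine ⟨pb.gen, ?_⟩
  convert hli using 1
  ext i
  fin_cases i <;> simp

end

theorem linearIndependent_triple_iff {V : Type v} [AddCommGroup V] [Module K V] {x y z : V} :
    LinearIndependent K ![x, y, z] ↔
      ∀ r s t : K, r • x + s • y + t • z = 0 → r = 0 ∧ s = 0 ∧ t = 0 := by
  simp [Fintype.linearIndependent_iff, Fin.forall_fin_succ_pi, Fin.sum_univ_three,
    Fin.forall_fin_succ]

theorem one_add_ne_zero_of_linearIndependent (hθ : LinearIndependent K ![1, θ, θ ^ 2]) :
    1 + θ ≠ 0 := fun hzero => by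
  have hpair := (linearIndependent_triple_iff.1 hθ) 1 1 0
    (by rw [one_smul, one_smul, zero_smul, add_zero, hzero])
  exact one_ne_zero hpair.1

theorem linearIndependent_one_inv_one_add_inv (hθ : LinearIndependent K ![1, θ, θ ^ 2]) :
    LinearIndependent K ![1, θ⁻¹, (1 + θ)⁻¹] := by
  have hθ0 : θ ≠ 0 := hθ.ne_zero 1
  have hθ1 := one_add_ne_zero_of_linearIndependent hθ
  rw [linearIndependent_triple_iff] at hθ ⊢
  intro r s t hsum
  have hpoly : s • (1 : F) + (r + s + t) • θ + r • θ ^ 2 = 0 := by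
    simp only [Algebra.smul_def, map_add] at hsum ⊢
    field_simp at hsum
    linear_combination hsum
  obtain ⟨hs, hrst, hr⟩ := hθ _ _ _ hpoly
  exact ⟨hr, hs, by simpa only [hr, hs, zero_add] using hrst⟩

end TraceForm

section DesarguesianForm

variable {K : Type u} [Field K] {F : Type w} [Field F] [Algebra K F]

theorem desarguesianForm_polarBilin (a d a' d' : K) (β γ β' γ' : F) :
    (desarguesianForm K F).polarBilin (a, β, γ, d) (a', β', γ', d') =
      a * d' + a' * d + Algebra.trace K F (β * γ' + β' * γ) := by
  have hadd := map_add_polarBilin (desarguesianForm K F) (a, β, γ, d) (a', β', γ', d')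
  simp only [Prod.mk_add_mk, desarguesianForm_apply, add_mul, mul_add, map_add] at hadd ⊢
  linear_combination -hadd

theorem isOPlusSpace_desarguesianForm [FiniteDimensional K F] [Algebra.IsSeparable K F] :
    IsOPlusSpace (finrank K F + 1) (desarguesianForm K F) := by
  refine ⟨by simp; ring, ?_, ?_⟩
  · suffices hleft : ∀ x, (∀ y, (desarguesianForm K F).polarBilin x y = 0) → x = 0 from
      ⟨hleft, fun y hy => hleft y fun x => by rw [polarBilin_comm, hy x]⟩
    rintro ⟨a, β, γ, d⟩ hx
    simp only [Prod.forall, desarguesianForm_polarBilin] at hx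
    have ha : a = 0 := by simpa using hx 0 0 0 1
    have hd : d = 0 := by simpa using hx 1 0 0 0
    have hβ : β = 0 := (traceForm_nondegenerate K F).1 β fun δ => by simpa using hx 0 0 δ 0
    have hγ : γ = 0 := (traceForm_nondegenerate K F).2 γ fun δ => by simpa using hx 0 δ 0 0
    rw [ha, hβ, hγ, hd]
    rfl
  · let f : (K × F) →ₗ[K] (K × F × F × K) :=
      LinearMap.prod (LinearMap.fst K K F) (LinearMap.prod (LinearMap.snd K K F) 0)
    have hf : Function.Injective f := fun x y hxy =>
      Prod.ext (congrArg (fun z : K × F × F × K => z.1) hxy)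
        (congrArg (fun z : K × F × F × K => z.2.1) hxy)
    refine ⟨LinearMap.range f, ?_, ?_⟩
    · rintro _ ⟨⟨a, β⟩, rfl⟩
      change desarguesianForm K F (a, β, 0, 0) = 0
      rw [desarguesianForm_apply, mul_zero, mul_zero, map_zero, add_zero]
    · rw [LinearMap.finrank_range_of_inj hf, finrank_prod, finrank_self, add_comm]

/-- The vectors whose spans are the points of the desarguesian ovoid; `none` indexes the point at
infinity `⟨(0, 0, 0, 1)⟩`. -/
noncomputable def desarguesianVector (K : Type u) [Field K] {F : Type w} [Field F] [Algebra K F] :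
    Option F → K × F × F × K
  | none => (0, 0, 0, 1)
  | some t => (1, t, t ^ (Nat.card K + Nat.card K ^ 2), Algebra.norm K t)

theorem desarguesianPoints_eq_range (K : Type u) [Field K] (F : Type w) [Field F] [Algebra K F] :
    desarguesianPoints K F = Set.range fun o : Option F => span K {desarguesianVector K o} := by
  ext p
  simp only [desarguesianPoints, Set.mem_union, Set.mem_singleton_iff, Set.mem_range,
    Option.exists, desarguesianVector]
  exact or_congr_left eq_comm

theorem desarguesianVector_some_zero [Finite K] [FiniteDimensional K F] :
    desarguesianVector K (some (0 : F)) = (1, 0, 0, 0) := by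
  rw [desarguesianVector, Algebra.norm_zero, zero_pow (Nat.add_pos_left Nat.card_pos _).ne']

theorem smul_pow_card_add_card_sq (k : K) (t : F) [Finite K] :
    (k • t) ^ (Nat.card K + Nat.card K ^ 2) = k ^ 2 • t ^ (Nat.card K + Nat.card K ^ 2) := by
  have := Fintype.ofFinite K
  rw [smul_pow, pow_add k, Nat.card_eq_fintype_card, FiniteField.pow_card, FiniteField.pow_card_pow,
    ← sq]

section FiniteExtension

variable [Finite F] (hF : finrank K F = 3)
include hF

theorem algebraMap_norm_of_finrank_eq_three (t : F) :
    algebraMap K F (Algebra.norm K t) = t * t ^ (Nat.card K + Nat.card K ^ 2) := by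
  rw [FiniteField.algebraMap_norm_eq_pow_sum, hF, ← pow_succ']
  simp only [Finset.sum_range_succ, Finset.sum_range_zero, pow_zero, pow_one, zero_add]
  rw [add_assoc, add_comm 1]

theorem algebraMap_trace_of_finrank_eq_three (t : F) :
    algebraMap K F (Algebra.trace K F t) = t + t ^ Nat.card K + t ^ Nat.card K ^ 2 := by
  rw [FiniteField.algebraMap_trace_eq_sum_pow, hF]
  simp [Finset.sum_range_succ]

/-- Expand `(s + t) (s + t)^q (s + t)^(q²)`; the six mixed terms are the conjugates of two. -/
theorem norm_add_of_finrank_eq_three (s t : F) :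
    Algebra.norm K (s + t) = Algebra.norm K s + Algebra.norm K t +
      Algebra.trace K F (s * t ^ (Nat.card K + Nat.card K ^ 2) +
        t * s ^ (Nat.card K + Nat.card K ^ 2)) := by
  have : Finite K := Finite.of_injective _ (algebraMap K F).injective
  have := Fintype.ofFinite K
  have := Fintype.ofFinite F
  have hadd (x y : F) : (x + y) ^ Nat.card K = x ^ Nat.card K + y ^ Nat.card K := by
    simpa [← Nat.card_eq_fintype_card] using map_add (FiniteField.frobeniusAlgHom K F) x y
  have hcube (x : F) : ((x ^ Nat.card K) ^ Nat.card K) ^ Nat.card K = x := by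
    rw [← pow_mul, ← pow_mul, ← pow_three, ← hF, ← natCard_eq_pow_finrank,
      Nat.card_eq_fintype_card, FiniteField.pow_card]
  apply (algebraMap K F).injective
  simp only [map_add, algebraMap_norm_of_finrank_eq_three hF,
    algebraMap_trace_of_finrank_eq_three hF, pow_add, mul_pow, sq (Nat.card K), pow_mul, hadd,
    hcube]
  ring

variable [CharP K 2]

theorem desarguesianForm_desarguesianVector (o : Option F) :
    desarguesianForm K F (desarguesianVector K o) = 0 := by
  rcases o with _ | t
  · simp [desarguesianVector, desarguesianForm_apply]
  · rw [desarguesianVector, desarguesianForm_apply, ← algebraMap_norm_of_finrank_eq_three hF,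
      Algebra.trace_algebraMap, hF, one_mul, succ_nsmul, two_nsmul, CharTwo.add_self_eq_zero,
      zero_add, CharTwo.add_self_eq_zero]

theorem polarBilin_desarguesianVector_eq_zero_iff {o o' : Option F} :
    (desarguesianForm K F).polarBilin (desarguesianVector K o) (desarguesianVector K o') = 0 ↔
      o = o' := by
  have : CharP F 2 := charP_of_injective_algebraMap (algebraMap K F).injective 2
  rcases o with _ | t <;> rcases o' with _ | s <;>
    simp only [desarguesianVector, desarguesianForm_polarBilin]
  · simp
  · simp
  · simp
  · rw [one_mul, one_mul, add_comm (Algebra.norm K s), ← norm_add_of_finrank_eq_three hF,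
      Algebra.norm_eq_zero_iff, CharTwo.add_eq_zero, Option.some_inj]

theorem exists_smul_inv_pow_eq {u : F} (hu : u ≠ 0) :
    ∃ s : K, s ≠ 0 ∧ (s • u⁻¹) ^ (Nat.card K + Nat.card K ^ 2) = u := by
  have : Finite K := Finite.of_injective _ (algebraMap K F).injective
  obtain ⟨s, hs⟩ := FiniteField.isSquare_of_char_two (ringChar.eq_iff.2 inferInstance)
    (Algebra.norm K u)
  have hs0 : s ≠ 0 := by
    rintro rfl
    exact Algebra.norm_ne_zero_iff.2 hu (by rw [hs, mul_zero])
  have hnorm : Algebra.norm K (s • u⁻¹) = s := by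
    rw [Algebra.smul_def, map_mul, Algebra.norm_algebraMap, hF, Algebra.norm_inv, hs]
    field_simp
  refine ⟨s, hs0, mul_left_cancel₀ (smul_ne_zero hs0 (inv_ne_zero hu)) ?_⟩
  rw [← algebraMap_norm_of_finrank_eq_three hF, hnorm, smul_mul_assoc, inv_mul_cancel₀ hu,
    Algebra.algebraMap_eq_smul_one]

/-- For `t = k s u⁻¹` with `k ∈ K` the hypothesis reads `k s T(c u⁻¹) + k² T(b u) = 0`, and a
nonzero polynomial `k ↦ k x + k² y` has at most two roots. -/
theorem trace_mul_eq_zero_and_trace_mul_inv_eq_zero (hK : 2 < Nat.card K) {b c u : F} (hu : u ≠ 0)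
    (h : ∀ (t : F) (k : K), t ^ (Nat.card K + Nat.card K ^ 2) = k • u →
      Algebra.trace K F (t * c + b * t ^ (Nat.card K + Nat.card K ^ 2)) = 0) :
    Algebra.trace K F (b * u) = 0 ∧ Algebra.trace K F (c * u⁻¹) = 0 := by
  have : Finite K := Finite.of_injective _ (algebraMap K F).injective
  obtain ⟨s, hs0, hs⟩ := exists_smul_inv_pow_eq hF hu
  have hquad (k : K) :
      k * (s * Algebra.trace K F (c * u⁻¹)) + k ^ 2 * Algebra.trace K F (b * u) = 0 := by
    have hpow : (k • s • u⁻¹) ^ (Nat.card K + Nat.card K ^ 2) = k ^ 2 • u := by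
      rw [smul_pow_card_add_card_sq, hs]
    have htrace := h _ _ hpow
    rwa [hpow, map_add, smul_mul_assoc, smul_mul_assoc, mul_comm u⁻¹, mul_smul_comm, map_smul,
      map_smul, map_smul] at htrace
  obtain ⟨k, -, hk⟩ := Set.exists_mem_notMem_of_ncard_lt_ncard
    (s := {0, 1}) (t := (Set.univ : Set K)) (by rwa [Set.ncard_pair zero_ne_one, Set.ncard_univ])
  obtain ⟨hk0, hk1⟩ : k ≠ 0 ∧ k ≠ 1 := by simpa using hk
  have hb : Algebra.trace K F (b * u) = 0 := by
    have hprod : k * (k - 1) * Algebra.trace K F (b * u) = 0 := by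
      linear_combination hquad k - k * hquad 1
    exact (mul_eq_zero.1 hprod).resolve_left (mul_ne_zero hk0 (sub_ne_zero.2 hk1))
  have hc := hquad 1
  rw [hb, mul_zero, add_zero, one_mul] at hc
  exact ⟨hb, (mul_eq_zero.1 hc).resolve_left hs0⟩

theorem mem_span_of_perp_desarguesianVector (hK : 2 < Nat.card K) {θ β : F}
    (hθ : LinearIndependent K ![1, θ, θ ^ 2])
    (hβ : ∀ b : F, b ∈ span K {β} ↔
      Algebra.trace K F (b * 1) = 0 ∧ Algebra.trace K F (b * θ) = 0) {x : K × F × F × K}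
    (hx : ∀ o : Option F,
      (desarguesianForm K F).polarBilin (0, β, 0, 0) (desarguesianVector K o) = 0 →
        (desarguesianForm K F).polarBilin (desarguesianVector K o) x = 0) :
    x ∈ span K {((0 : K), β, (0 : F), (0 : K))} := by
  have : Finite K := Finite.of_injective _ (algebraMap K F).injective
  obtain ⟨a, b, c, d⟩ := x
  have ha : a = 0 := by
    simpa only [desarguesianVector, desarguesianForm_polarBilin, zero_mul, mul_zero, mul_one,
      zero_add, add_zero, map_zero, true_imp_iff] using hx none
  have hd : d = 0 := by
    simpa only [desarguesianVector_some_zero, desarguesianForm_polarBilin, ha, zero_mul, mul_zero,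
      one_mul, zero_add, add_zero, map_zero, true_imp_iff] using hx (some 0)
  have hsome (t : F) (ht : Algebra.trace K F (β * t ^ (Nat.card K + Nat.card K ^ 2)) = 0) :
      Algebra.trace K F (t * c + b * t ^ (Nat.card K + Nat.card K ^ 2)) = 0 := by
    simpa only [desarguesianVector, desarguesianForm_polarBilin, ha, hd, one_mul, zero_mul,
      mul_zero, zero_add, add_zero, ht, true_imp_iff] using hx (some t)
  have hzero (u : F) (hu : u ≠ 0) (hβu : Algebra.trace K F (β * u) = 0) :
      Algebra.trace K F (b * u) = 0 ∧ Algebra.trace K F (c * u⁻¹) = 0 :=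
    trace_mul_eq_zero_and_trace_mul_inv_eq_zero hF hK hu fun t k ht =>
      hsome t (by rw [ht, mul_smul_comm, map_smul, hβu, smul_zero])
  obtain ⟨hβ1, hβθ⟩ := (hβ β).1 (mem_span_singleton_self β)
  obtain ⟨hb1, hc1⟩ := hzero 1 one_ne_zero hβ1
  obtain ⟨hbθ, hcθ⟩ := hzero θ (hθ.ne_zero 1) hβθ
  obtain ⟨-, hcθ1⟩ := hzero (1 + θ) (one_add_ne_zero_of_linearIndependent hθ)
    (by rw [mul_add, map_add, hβ1, hβθ, add_zero])
  have hspan := (linearIndependent_one_inv_one_add_inv hθ).span_eq_top_of_card_eq_finrank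
    (by rw [hF, Fintype.card_fin])
  have hc : c = 0 := eq_zero_of_trace_mul_eq_zero hspan fun i => by
    fin_cases i
    exacts [by simpa using hc1, hcθ, hcθ1]
  obtain ⟨k, rfl⟩ := mem_span_singleton.1 ((hβ b).2 ⟨hb1, hbθ⟩)
  exact mem_span_singleton.2 ⟨k, by simp [ha, hc, hd]⟩

end FiniteExtension

end DesarguesianForm

section DesarguesianOvoid

variable {K : Type u} [Field K] {V : Type v} [AddCommGroup V] [Module K V] {Q : QuadraticForm K V}

theorem polarBilin_isometryEquiv {V' : Type w} [AddCommGroup V'] [Module K V']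
    {Q' : QuadraticForm K V'} (e : Q'.IsometryEquiv Q) (x y : V') :
    Q.polarBilin (e x) (e y) = Q'.polarBilin x y := by
  simp only [QuadraticMap.polarBilin_apply_apply, QuadraticMap.polar, ← map_add, e.map_app]

theorem IsOPlusSpace.nonempty_isometryEquiv {V' : Type w} [AddCommGroup V'] [Module K V']
    [FiniteDimensional K V] [FiniteDimensional K V'] {n : ℕ} {Q' : QuadraticForm K V'}
    (h : IsOPlusSpace n Q) (h' : IsOPlusSpace n Q') : Nonempty (Q'.IsometryEquiv Q) := by
  obtain ⟨e, he⟩ := h.exists_coordinates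
  obtain ⟨e', he'⟩ := h'.exists_coordinates
  refine ⟨⟨e'.symm.trans e, fun x => ?_⟩⟩
  obtain ⟨⟨y, z⟩, rfl⟩ := e'.surjective x
  change Q (e (e'.symm (e' (y, z)))) = _
  rw [e'.symm_apply_apply, he, he']

theorem span_singleton_notMem_range {ι : Type*} {v : ι → V}
    (hpolar : ∀ i j, Q.polarBilin (v i) (v j) = 0 ↔ i = j) {y : V} {i j : ι} (hij : i ≠ j)
    (hi : Q.polarBilin y (v i) = 0) (hj : Q.polarBilin y (v j) = 0) :
    span K {y} ∉ Set.range fun i => span K {v i} := by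
  rintro ⟨o, ho⟩
  obtain ⟨k, hk⟩ := mem_span_singleton.1 (ho.le (mem_span_singleton_self (v o)))
  have heq {l : ι} (hl : Q.polarBilin y (v l) = 0) : o = l := (hpolar o l).1 <| by
    rw [← hk, map_smul, LinearMap.smul_apply, hl, smul_zero]
  exact hij ((heq hi).symm.trans (heq hj))

theorem isOvoid_range_span_singleton [Finite K] [FiniteDimensional K V] {ι : Type*} {v : ι → V}
    (hV : IsOPlusSpace 4 Q) (hsingular : ∀ i, Q (v i) = 0)
    (hpolar : ∀ i j, Q.polarBilin (v i) (v j) = 0 ↔ i = j) (hι : Nat.card ι = Nat.card K ^ 3 + 1) :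
    IsOvoid Q (Set.range fun i => span K {v i}) := by
  have hpos : 0 < Nat.card K ^ 3 := pow_pos Nat.card_pos 3
  have : Finite ι := Nat.finite_of_card_ne_zero (by omega)
  have : Nontrivial ι := Finite.one_lt_card_iff_nontrivial.1 (by omega)
  have hne (i : ι) : v i ≠ 0 := fun hi => by
    obtain ⟨j, hj⟩ := exists_ne i
    exact hj ((hpolar i j).1 (by rw [hi, map_zero, LinearMap.zero_apply])).symm
  have hperp (i j : ι) (h : span K {v i} ≤ perp Q (span K {v j})) : i = j := by
    rw [span_singleton_le_iff_mem, mem_perp_span_singleton, hpolar] at h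
    exact h.symm
  have hpartial : IsPartialOvoid Q (Set.range fun i => span K {v i}) := by
    refine isPartialOvoid_iff.2 ⟨?_, ?_⟩
    · rintro _ ⟨i, rfl⟩
      exact isSingularPoint_iff.2 ⟨v i, hne i, hsingular i, rfl⟩
    · rintro _ ⟨i, rfl⟩ _ ⟨j, rfl⟩ hij
      rw [hperp i j hij]
  have hinj : Function.Injective fun i => span K {v i} := fun i j hij =>
    hperp i j (hij.le.trans (isTotallySingular_span_singleton (hsingular j)).le_perp)
  exact hpartial.isOvoid_of_ncard hV ((Nat.card_range_of_injective hinj).trans hι)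

theorem isExchangePoint_range_span_singleton {ι : Type*} {v : ι → V} {y : V} (hy : y ≠ 0)
    (hQy : Q y = 0) (hmem : span K {y} ∉ Set.range fun i => span K {v i})
    (hperp : ∀ x, (∀ i, Q.polarBilin y (v i) = 0 → Q.polarBilin (v i) x = 0) → x ∈ span K {y}) :
    IsExchangePoint Q (Set.range fun i => span K {v i}) (span K {y}) := by
  refine ⟨isSingularPoint_iff.2 ⟨y, hy, hQy, rfl⟩, hmem, fun b hb hbp => ?_⟩
  obtain ⟨x, hx, -, rfl⟩ := isSingularPoint_iff.1 hb
  obtain ⟨k, rfl⟩ := mem_span_singleton.1 (hperp x fun i hi => by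
    have hi' : span K {v i} ∈ perpInter Q (Set.range fun i => span K {v i}) (span K {y}) :=
      ⟨⟨i, rfl⟩, by rwa [span_singleton_le_iff_mem, mem_perp_span_singleton]⟩
    have hle := hbp.trans (perp_anti (le_sSup hi'))
    rwa [span_singleton_le_iff_mem, mem_perp_span_singleton] at hle)
  exact span_singleton_smul_eq (IsUnit.mk0 k (left_ne_zero_of_smul hx)) y

theorem exists_cubic_extension (K : Type u) [Field K] [Finite K] :
    ∃ (F : Type u) (_ : Field F) (_ : Algebra K F), finrank K F = 3 := by
  obtain ⟨p, hp⟩ := CharP.exists K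
  have : Fact p.Prime := ⟨CharP.char_is_prime K p⟩
  refine ⟨ULift.{u} (FiniteField.Extension K p 3), inferInstance, inferInstance, ?_⟩
  rw [finrank_ulift]
  exact FiniteField.finrank_extension K p 3

theorem isDesarguesianOvoid_range {F : Type u} [Field F] [Algebra K F] (hF : finrank K F = 3)
    (e : (desarguesianForm K F).IsometryEquiv Q) :
    IsDesarguesianOvoid Q (Set.range fun o : Option F => span K {e (desarguesianVector K o)}) := by
  refine ⟨F, _, _, hF, e, ?_⟩
  rw [desarguesianPoints_eq_range, ← Set.range_comp]
  refine congrArg Set.range (funext fun o => ?_)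
  rw [Function.comp_apply, map_span, Set.image_singleton]
  rfl

theorem polarBilin_isometryEquiv_desarguesianVector_eq_zero_iff [CharP K 2] {F : Type w} [Field F]
    [Algebra K F] [Finite F] (hF : finrank K F = 3) (e : (desarguesianForm K F).IsometryEquiv Q)
    (o o' : Option F) :
    Q.polarBilin (e (desarguesianVector K o)) (e (desarguesianVector K o')) = 0 ↔ o = o' := by
  rw [polarBilin_isometryEquiv, polarBilin_desarguesianVector_eq_zero_iff hF]

section Exchange

variable [FiniteDimensional K V] [CharP K 2] {F : Type w} [Field F] [Algebra K F] [Finite F]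
  (hV : IsOPlusSpace 4 Q) (hF : finrank K F = 3) (e : (desarguesianForm K F).IsometryEquiv Q)
include hV hF

theorem isOvoid_range_desarguesianVector :
    IsOvoid Q (Set.range fun o : Option F => span K {e (desarguesianVector K o)}) := by
  have : Finite K := Finite.of_injective _ (algebraMap K F).injective
  refine isOvoid_range_span_singleton hV (fun o => ?_)
    (polarBilin_isometryEquiv_desarguesianVector_eq_zero_iff hF e) ?_
  · rw [e.map_app, desarguesianForm_desarguesianVector hF]
  · rw [Finite.card_option, natCard_eq_pow_finrank (K := K), hF]

theorem isExchangePoint_range_desarguesianVector {θ β : F}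
    (hθ : LinearIndependent K ![1, θ, θ ^ 2]) (hβ0 : β ≠ 0)
    (hβ : ∀ b : F, b ∈ span K {β} ↔
      Algebra.trace K F (b * 1) = 0 ∧ Algebra.trace K F (b * θ) = 0) :
    IsExchangePoint Q (Set.range fun o : Option F => span K {e (desarguesianVector K o)})
      (span K {e (0, β, 0, 0)}) := by
  have : Finite K := Finite.of_injective _ (algebraMap K F).injective
  have hy : e (0, β, 0, 0) ≠ 0 := by simpa using hβ0
  have hQy : Q (e (0, β, 0, 0)) = 0 := by
    rw [e.map_app, desarguesianForm_apply, zero_mul, mul_zero, map_zero, add_zero]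
  have hmem : span K {e (0, β, 0, 0)} ∉
      Set.range fun o : Option F => span K {e (desarguesianVector K o)} := by
    refine span_singleton_notMem_range
      (polarBilin_isometryEquiv_desarguesianVector_eq_zero_iff hF e)
      (Option.some_ne_none (0 : F)) ?_ ?_
    · rw [polarBilin_isometryEquiv, desarguesianVector_some_zero, desarguesianForm_polarBilin]
      simp
    · rw [polarBilin_isometryEquiv, desarguesianVector, desarguesianForm_polarBilin]
      simp
  rcases (Nat.succ_le_of_lt (Finite.one_lt_card (α := K))).eq_or_lt with hK | hK
  · exact (isOvoid_range_desarguesianVector hV hF e).isExchangePoint_of_card_eq_two hV hK.symm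
      (isSingularPoint_iff.2 ⟨_, hy, hQy, rfl⟩) hmem
  · refine isExchangePoint_range_span_singleton hy hQy hmem fun x hx => ?_
    obtain ⟨x, rfl⟩ : ∃ z, e z = x := e.surjective x
    simp only [polarBilin_isometryEquiv] at hx
    obtain ⟨k, rfl⟩ := mem_span_singleton.1 (mem_span_of_perp_desarguesianVector hF hK hθ hβ hx)
    exact mem_span_singleton.2 ⟨k, (map_smul e k _).symm⟩

end Exchange

theorem IsOPlusSpace.exists_desarguesian [Finite K] [CharP K 2] [FiniteDimensional K V]
    (hV : IsOPlusSpace 4 Q) : ∃ (Ω : Set (Submodule K V)) (a : Submodule K V),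
      IsDesarguesianOvoid Q Ω ∧ IsOvoid Q Ω ∧ IsExchangePoint Q Ω a := by
  obtain ⟨F, _, _, hF⟩ := exists_cubic_extension K
  have : FiniteDimensional K F := .of_finrank_eq_succ hF
  have : Finite F := finite_of_finite K
  have hform := isOPlusSpace_desarguesianForm (K := K) (F := F)
  rw [hF] at hform
  obtain ⟨e⟩ := hV.nonempty_isometryEquiv hform
  obtain ⟨θ, hθ⟩ := exists_linearIndependent_one_self_sq hF
  have hpair : LinearIndependent K ![1, θ] := LinearIndependent.pair_iff.2 fun r s h => by
    obtain ⟨hr, hs, -⟩ := linearIndependent_triple_iff.1 hθ r s 0 (by rwa [zero_smul, add_zero])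
    exact ⟨hr, hs⟩
  obtain ⟨β, hβ0, hβ⟩ := exists_mem_span_singleton_iff_trace_mul_eq_zero hF hpair
  exact ⟨_, _, isDesarguesianOvoid_range hF e, isOvoid_range_desarguesianVector hV hF e,
    isExchangePoint_range_desarguesianVector hV hF e hθ hβ0 hβ⟩

end DesarguesianOvoid

section MaximalSpreads

variable {K : Type u} [Field K] [Finite K] {V : Type v} [AddCommGroup V] [Module K V]
  [FiniteDimensional K V] {Q : QuadraticForm K V} {Ω : Set (Submodule K V)} {a : Submodule K V}

theorem IsExchangePoint.maximal_orthogonal_image (ha : IsExchangePoint Q Ω a) (hΩ : IsOvoid Q Ω)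
    (hV : IsOPlusSpace 4 Q) (τ : Triality Q) :
    Maximal (IsOrthogonalPartialSpread 4 Q) (τ.image (exchange Q Ω a)) := by
  obtain ⟨M, h⟩ := τ.exists_rotatesFrom
  exact h.maximal_orthogonal_image hV (ha.maximal_exchange hΩ hV)

theorem IsExchangePoint.maximal_symplectic_image [CharP K 2] (ha : IsExchangePoint Q Ω a)
    (hΩ : IsOvoid Q Ω) (hV : IsOPlusSpace 4 Q) (τ : Triality Q) :
    Maximal (IsSymplecticPartialSpread 4 Q.polarBilin) (τ.image (exchange Q Ω a)) := by
  obtain ⟨M, h⟩ := τ.exists_rotatesFrom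
  exact h.maximal_symplectic_image hV (ha.maximal_exchange hΩ hV)

theorem IsExchangePoint.ncard_image (ha : IsExchangePoint Q Ω a) (hΩ : IsOvoid Q Ω)
    (hV : IsOPlusSpace 4 Q) (τ : Triality Q) :
    ((τ.image (exchange Q Ω a)).ncard : ℤ) = (Nat.card K : ℤ) ^ 3 - (Nat.card K : ℤ) ^ 2 + 1 := by
  rw [τ.ncard_image (hΩ.1.exchange ha.isSingularPoint).1,
    hΩ.ncard_exchange hV ha.isSingularPoint ha.notMem]

end MaximalSpreads

end PolarSpread

theorem mainTheorem5_general {K : Type*} [Field K] [Finite K] {V : Type*} [AddCommGroup V]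
    [Module K V] (q : ℕ) (hq : Nat.card K = q) :
    (∀ Q : QuadraticForm K V, PolarSpread.IsOPlusSpace 4 Q →
      Nonempty (PolarSpread.Triality Q) ∧
      (∀ (τ : PolarSpread.Triality Q) (Ω : Set (Submodule K V)) (a : Submodule K V),
        PolarSpread.IsOvoid Q Ω → PolarSpread.IsExchangePoint Q Ω a →
          Maximal (PolarSpread.IsOrthogonalPartialSpread 4 Q)
            (τ.image (PolarSpread.exchange Q Ω a)) ∧
          ((τ.image (PolarSpread.exchange Q Ω a)).ncard : ℤ) = (q : ℤ) ^ 3 - (q : ℤ) ^ 2 + 1 ∧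
          (Even q →
            Maximal (PolarSpread.IsSymplecticPartialSpread 4 Q.polarBilin)
              (τ.image (PolarSpread.exchange Q Ω a)))) ∧
      (Even q →
        ∃ (τ : PolarSpread.Triality Q) (Ω : Set (Submodule K V)) (a : Submodule K V),
          PolarSpread.IsDesarguesianOvoid Q Ω ∧ PolarSpread.IsOvoid Q Ω ∧
          PolarSpread.IsExchangePoint Q Ω a ∧
          Maximal (PolarSpread.IsOrthogonalPartialSpread 4 Q)
            (τ.image (PolarSpread.exchange Q Ω a)) ∧
          Maximal (PolarSpread.IsSymplecticPartialSpread 4 Q.polarBilin)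
            (τ.image (PolarSpread.exchange Q Ω a)) ∧
          ((τ.image (PolarSpread.exchange Q Ω a)).ncard : ℤ) =
            (q : ℤ) ^ 3 - (q : ℤ) ^ 2 + 1)) ∧
    (Even q → ∀ B : LinearMap.BilinForm K V, PolarSpread.IsSpSpace 4 B →
      ∃ S : Set (Submodule K V),
        Maximal (PolarSpread.IsSymplecticPartialSpread 4 B) S ∧
        (S.ncard : ℤ) = (q : ℤ) ^ 3 - (q : ℤ) ^ 2 + 1) := by
  subst hq
  refine ⟨fun Q hQ => ?_, fun hq B hB => ?_⟩
  · have : FiniteDimensional K V := Module.finite_of_finrank_pos (by rw [hQ.finrank_eq]; norm_num)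
    refine ⟨hQ.nonempty_triality, fun τ Ω a hΩ ha => ?_, fun hq => ?_⟩
    · refine ⟨ha.maximal_orthogonal_image hΩ hQ τ, ha.ncard_image hΩ hQ τ, fun hq => ?_⟩
      have := PolarSpread.charP_two_of_even_card hq
      exact ha.maximal_symplectic_image hΩ hQ τ
    · have := PolarSpread.charP_two_of_even_card hq
      obtain ⟨τ⟩ := hQ.nonempty_triality
      obtain ⟨Ω, a, hdesarguesian, hΩ, ha⟩ := hQ.exists_desarguesian
      exact ⟨τ, Ω, a, hdesarguesian, hΩ, ha, ha.maximal_orthogonal_image hΩ hQ τ,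
        ha.maximal_symplectic_image hΩ hQ τ, ha.ncard_image hΩ hQ τ⟩
  · have := PolarSpread.charP_two_of_even_card hq
    have : FiniteDimensional K V := Module.finite_of_finrank_pos (by rw [hB.finrank_eq]; norm_num)
    obtain ⟨Q, rfl, hQ⟩ := hB.exists_quadraticForm
    obtain ⟨τ⟩ := hQ.nonempty_triality
    obtain ⟨Ω, a, -, hΩ, ha⟩ := hQ.exists_desarguesian
    exact ⟨_, ha.maximal_symplectic_image hΩ hQ τ, ha.ncard_image hΩ hQ τ⟩

theorem mainTheorem5 {K : Type*} [Field K] [Finite K] {V : Type*} [AddCommGroup V] [Module K V]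
    (q : ℕ) (hq : Nat.card K = q) :
    (∀ Q : QuadraticForm K V, PolarSpread.IsOPlusSpace 4 Q →
      Nonempty (PolarSpread.Triality Q) ∧
      (2 < q →
        ∀ (τ : PolarSpread.Triality Q) (Ω : Set (Submodule K V)) (a : Submodule K V),
          PolarSpread.IsOvoid Q Ω → PolarSpread.IsExchangePoint Q Ω a →
            Maximal (PolarSpread.IsOrthogonalPartialSpread 4 Q)
              (τ.image (PolarSpread.exchange Q Ω a)) ∧
            ((τ.image (PolarSpread.exchange Q Ω a)).ncard : ℤ) = (q : ℤ) ^ 3 - (q : ℤ) ^ 2 + 1 ∧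
            (Even q →
              Maximal (PolarSpread.IsSymplecticPartialSpread 4 Q.polarBilin)
                (τ.image (PolarSpread.exchange Q Ω a)))) ∧
      (2 < q → Even q →
        ∃ (τ : PolarSpread.Triality Q) (Ω : Set (Submodule K V)) (a : Submodule K V),
          PolarSpread.IsDesarguesianOvoid Q Ω ∧ PolarSpread.IsOvoid Q Ω ∧
          PolarSpread.IsExchangePoint Q Ω a ∧
          Maximal (PolarSpread.IsOrthogonalPartialSpread 4 Q)
            (τ.image (PolarSpread.exchange Q Ω a)) ∧
          Maximal (PolarSpread.IsSymplecticPartialSpread 4 Q.polarBilin)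
            (τ.image (PolarSpread.exchange Q Ω a)) ∧
          ((τ.image (PolarSpread.exchange Q Ω a)).ncard : ℤ) =
            (q : ℤ) ^ 3 - (q : ℤ) ^ 2 + 1)) ∧
    (Even q → ∀ B : LinearMap.BilinForm K V, PolarSpread.IsSpSpace 4 B →
      ∃ S : Set (Submodule K V),
        Maximal (PolarSpread.IsSymplecticPartialSpread 4 B) S ∧
        (S.ncard : ℤ) = (q : ℤ) ^ 3 - (q : ℤ) ^ 2 + 1) := by
  obtain ⟨hO, hSp⟩ := mainTheorem5_general (V := V) q hq
  exact ⟨fun Q hQ => ⟨(hO Q hQ).1, fun _ => (hO Q hQ).2.1, fun _ => (hO Q hQ).2.2⟩, hSp⟩
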